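/- There is a function $\eta:\mathbb{N}\to\mathbb{R}$ with $\eta(m)\to 0$ as $m\to\infty$ such that the following holds. Let $H=(V,E)$ be a finite hypergraph (without repeated edges) all of whose edges have size at most $d$. One unknown edge $e\in E$ is defective; a test is a subset of $V$, and its result is positive if it intersects $e$ and negative otherwise. Then there are a number $$N\le d\,\log_2 e\,\log_2|E|\,\bigl(1+\eta(|E|)\bigr)$$ (where $\log_2 e$ is the binary logarithm of Euler's number) and $N$ tests, all fixed in advance (that is, non-adaptively chosen), whose results always determine the defective edge. In particular, a defective edge can be found non-adaptively with at most $d\log_2 e\,\log_2|E|\,(1+o(1))$ tests, where the $o(1)$ is as $|E|\to\infty$, uniformly over $d$ and over all such hypergraphs. -/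

import Mathlib

namespace GroupTesting

/-- A non-adaptive search procedure with `N` tests on a hypergraph `H`: `N` sets of vertices that
are all fixed in advance, and a rule that names a set from the list of the `N` test results. -/
structure NonadaptiveAlgorithm {V : Type*} (H : Hypergraph V) (N : ℕ) where
  /-- The set of vertices that the `i`-th test examines. -/
  test : Fin N → Set V
  test_subset : ∀ i, test i ⊆ H.vertexSet
  /-- The answer, computed from the test results only (`True` stands for a positive result). -/
  decode : (Fin N → Prop) → Set V

/-- The results of the tests when `e` is the defective edge: the `i`-th test is positive exactly
when the tested set intersects `e`. -/
def NonadaptiveAlgorithm.outcome {V : Type*} {H : Hypergraph V} {N : ℕ}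
    (A : NonadaptiveAlgorithm H N) (e : Set V) : Fin N → Prop :=
  fun i => (A.test i ∩ e).Nonempty

/-- The procedure finds the defective edge, whichever edge of `H` it is. -/
def NonadaptiveAlgorithm.FindsDefectiveEdge {V : Type*} {H : Hypergraph V} {N : ℕ}
    (A : NonadaptiveAlgorithm H N) : Prop :=
  ∀ e ∈ H.edgeSet, A.decode (A.outcome e) = e

end GroupTesting

set_option linter.unusedSectionVars false

/-! Give each vertex a random word of length B over an alphabet of Q ≈ d / log 2 symbols, and let
test (j, s) examine the vertices whose j-th letter is s. The B·Q results reveal, for every j, the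
set of j-th letters on the defective edge. At this Q a given letter is missing from an edge of size
d with probability about 1/2, and B ≈ log₂ m blocks, m being the number of edges, exhaust the
permitted number of tests. It remains to find words for which no two edges show the same letters in
all coordinates.

Let θ = Q log 2 / d ≥ 1. In one coordinate, an edge agrees with itself minus a vertex with
probability at most 2^(-θ) (`deletionProb_le`), and with an edge that has two vertices outside it
with probability at most 2^(-2θ) (`remoteProb_le`). Since Bθ ≥ (1 + ε/2) log₂ m, the union bound
copes with both kinds: there are at most m² pairs of the second kind, and at most md of the first
kind or, uniformly in d, (m log₂ m)/2 by edge isoperimetry in the cube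
(`two_mul_insertionCount_le`). The critical pairs differ by the exchange of one vertex. Their
probability is close to 2^(-2θ) when d is large, which settles all d ≥ d₀(ε).

For a fixed d ≥ 2 only 2^(-3θ/2) is used (`exchangeProb_le`), so about m^(3/2) exchange pairs are
affordable. Call c a heavy core if at least √m edges arise from c by adding a vertex. There are at
most d√m heavy cores, covering at most d²√m vertices, and O_d(m^(3/2)) exchange pairs have a light
common part or move a covered vertex (`card_exchange_le`). For the other exchange pairs, the words
on heavy cores are fixed first. Two words conflict if some heavy core fails to tell them apart; this
is so rare that the remaining vertices, at most md, can be labelled one by one without conflicts.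
Conditioning on this multiplies the probability of an event on at most 2d vertices by at most 4^(2d)
(`exists_conflictFree`), so the union bound over the remaining pairs survives
(`separable_of_heavyCores`). The case d = 1 is binary search. -/

namespace GroupTesting

/-! ### Averages over finite types -/

section Average

variable {α β ι : Type*} [Fintype α] [Fintype β]

/-- The average of a real function on a finite type. -/
noncomputable def avg (F : α → ℝ) : ℝ := (∑ a, F a) / Fintype.card α

open Classical in
/-- The probability of a property of a uniformly random element of a finite type. -/
noncomputable def prob (p : α → Prop) : ℝ := avg fun a => if p a then (1 : ℝ) else 0

lemma avg_mono {F G : α → ℝ} (h : ∀ a, F a ≤ G a) : avg F ≤ avg G :=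
  div_le_div_of_nonneg_right (Finset.sum_le_sum fun a _ => h a) (Nat.cast_nonneg _)

lemma avg_nonneg {F : α → ℝ} (h : ∀ a, 0 ≤ F a) : 0 ≤ avg F :=
  div_nonneg (Finset.sum_nonneg fun a _ => h a) (Nat.cast_nonneg _)

lemma avg_add (F G : α → ℝ) : avg (fun a => F a + G a) = avg F + avg G := by
  simp [avg, Finset.sum_add_distrib, add_div]

lemma avg_sub (F G : α → ℝ) : avg (fun a => F a - G a) = avg F - avg G := by
  simp [avg, Finset.sum_sub_distrib, sub_div]

lemma avg_mul_left (c : ℝ) (F : α → ℝ) : avg (fun a => c * F a) = c * avg F := by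
  simp [avg, ← Finset.mul_sum, mul_div_assoc]

lemma avg_mul_right (c : ℝ) (F : α → ℝ) : avg (fun a => F a * c) = avg F * c := by
  simp [avg, ← Finset.sum_mul, div_mul_eq_mul_div]

lemma avg_div (c : ℝ) (F : α → ℝ) : avg (fun a => F a / c) = avg F / c := by
  simp only [div_eq_mul_inv]
  exact avg_mul_right _ _

lemma avg_sum (s : Finset ι) (F : ι → α → ℝ) :
    avg (fun a => ∑ i ∈ s, F i a) = ∑ i ∈ s, avg (F i) := by
  simp only [avg, ← Finset.sum_div]
  rw [Finset.sum_comm]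

lemma avg_const [Nonempty α] (c : ℝ) : avg (fun _ : α => c) = c := by
  have : (Fintype.card α : ℝ) ≠ 0 := by exact_mod_cast Fintype.card_ne_zero
  simp [avg, this]

lemma avg_prod (F : α × β → ℝ) : avg F = avg (fun a => avg fun b => F (a, b)) := by
  simp only [avg, ← Finset.sum_div, Fintype.sum_prod_type, Fintype.card_prod, Nat.cast_mul]
  rw [div_div, mul_comm]

lemma avg_equiv (e : α ≃ β) (F : β → ℝ) : avg (fun a => F (e a)) = avg F := by
  simp only [avg, Fintype.card_congr e, Equiv.sum_comp e F]

lemma exists_le_avg [Nonempty α] (F : α → ℝ) : ∃ a, F a ≤ avg F := by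
  by_contra! h
  have hpos : (0 : ℝ) < Fintype.card α := by exact_mod_cast Fintype.card_pos
  have h1 : ∑ _a : α, avg F < ∑ a, F a :=
    Finset.sum_lt_sum_of_nonempty Finset.univ_nonempty fun a _ => h a
  rw [Finset.sum_const, nsmul_eq_mul, Finset.card_univ, avg, mul_div_cancel₀ _ hpos.ne'] at h1
  exact lt_irrefl _ h1

lemma prob_nonneg (p : α → Prop) : 0 ≤ prob p :=
  avg_nonneg fun a => by split_ifs <;> norm_num

lemma prob_mono {p q : α → Prop} (h : ∀ a, p a → q a) : prob p ≤ prob q :=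
  avg_mono fun a => by
    by_cases hp : p a
    · simp [hp, h a hp]
    · simp only [hp, if_false]
      split_ifs <;> norm_num

lemma prob_equiv (e : α ≃ β) (p : β → Prop) : prob (fun a => p (e a)) = prob p := by
  unfold prob
  rw [← avg_equiv e]

lemma prob_eq_avg (p : α → Prop) [DecidablePred p] :
    prob p = avg fun a => if p a then (1 : ℝ) else 0 := by
  unfold prob
  congr 1
  funext a
  congr

lemma prob_eq_card_div (p : α → Prop) [DecidablePred p] :
    prob p = ((Finset.univ.filter p).card : ℝ) / Fintype.card α := by
  rw [prob_eq_avg, avg, Finset.sum_boole]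

lemma prob_mem [DecidableEq α] (s : Finset α) :
    prob (fun a => a ∈ s) = (s.card : ℝ) / Fintype.card α := by
  rw [prob_eq_card_div]; simp

/-- The first moment method. -/
lemma exists_forall_not_of_sum_prob_lt_one [Nonempty α] (s : Finset ι) (p : ι → α → Prop)
    (h : ∑ i ∈ s, prob (p i) < 1) : ∃ a, ∀ i ∈ s, ¬ p i a := by
  classical
  obtain ⟨a, ha⟩ := exists_le_avg fun a => ∑ i ∈ s, if p i a then (1 : ℝ) else 0
  refine ⟨a, fun i hi hpi => ?_⟩
  rw [avg_sum] at ha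
  have h2 : (1 : ℝ) ≤ ∑ i ∈ s, if p i a then (1 : ℝ) else 0 := by
    have := Finset.single_le_sum (f := fun i => if p i a then (1 : ℝ) else 0)
      (fun j _ => by split_ifs <;> norm_num) hi
    simpa [hpi] using this
  simp only [← prob_eq_avg] at ha
  linarith

end Average

/-! ### Random functions -/

section Functions

variable {V Ω : Type*} [Fintype V] [DecidableEq V] [Fintype Ω]

/-- Resampling one coordinate does not change an average. -/
lemma avg_update [Nonempty Ω] (v : V) (F : (V → Ω) → ℝ) :
    avg F = avg fun g => avg fun z => F (Function.update g v z) := by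
  -- The involution that trades the value at `v` for the spare sample preserves the uniform
  -- distribution on pairs.
  let e : ((V → Ω) × Ω) ≃ ((V → Ω) × Ω) :=
    { toFun := fun x => (Function.update x.1 v x.2, x.1 v)
      invFun := fun x => (Function.update x.1 v x.2, x.1 v)
      left_inv := fun x => by simp
      right_inv := fun x => by simp }
  have h := avg_equiv e fun x => F x.1
  rw [avg_prod, avg_prod] at h
  simp only [avg_const] at h
  exact h.symm

/-- Choosing the coordinates in `S` and the others independently does not change an average. -/
lemma avg_piecewise [Nonempty Ω] (S : Finset V) (F : (V → Ω) → ℝ) :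
    avg F = avg fun g => avg fun g' => F (S.piecewise g g') := by
  -- Two independent functions trade their values off `S`; this is again a measure-preserving
  -- involution.
  let e : ((V → Ω) × (V → Ω)) ≃ ((V → Ω) × (V → Ω)) :=
    { toFun := fun x => (S.piecewise x.1 x.2, S.piecewise x.2 x.1)
      invFun := fun x => (S.piecewise x.1 x.2, S.piecewise x.2 x.1)
      left_inv := fun x => by
        ext v <;> by_cases hv : v ∈ S <;> simp [hv]
      right_inv := fun x => by
        ext v <;> by_cases hv : v ∈ S <;> simp [hv] }
  have h := avg_equiv e fun x => F x.1
  rw [avg_prod, avg_prod] at h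
  simp only [avg_const] at h
  exact h.symm

/-- Events that depend on disjoint sets of coordinates are independent. -/
lemma prob_and_of_dependsOn [Nonempty Ω] (S : Finset V) (p q : (V → Ω) → Prop)
    (hp : ∀ g g', (∀ v ∈ S, g v = g' v) → (p g ↔ p g'))
    (hq : ∀ g g', (∀ v ∉ S, g v = g' v) → (q g ↔ q g')) :
    prob (fun g => p g ∧ q g) = prob p * prob q := by
  classical
  unfold prob
  rw [avg_piecewise S, ← avg_mul_right]
  congr 1
  funext g
  rw [← avg_mul_left]
  congr 1
  funext g'
  have h1 : p (S.piecewise g g') ↔ p g := hp _ _ fun v hv => by simp [hv]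
  have h2 : q (S.piecewise g g') ↔ q g' := hq _ _ fun v hv => by simp [hv]
  by_cases hpg : p g <;> by_cases hqg : q g' <;> simp [h1, h2, hpg, hqg]

/-- Rows of a uniformly random matrix are independent and uniformly distributed. -/
lemma prob_forall_row (B : ℕ) (p : (V → Ω) → Prop) :
    prob (fun l : V → Fin B → Ω => ∀ j, p fun v => l v j) = prob p ^ B := by
  classical
  have h1 : prob (fun l : V → Fin B → Ω => ∀ j, p fun v => l v j)
      = prob (fun l : Fin B → V → Ω => ∀ j, p (l j)) :=
    prob_equiv (Equiv.piComm fun (_ : V) (_ : Fin B) => Ω) fun l => ∀ j, p (l j)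
  rw [h1, prob_eq_card_div, prob_eq_card_div, div_pow]
  congr 1
  · have : (Finset.univ.filter fun l : Fin B → V → Ω => ∀ j, p (l j))
        = Fintype.piFinset fun _ : Fin B => Finset.univ.filter p := by
      ext l; simp
    rw [this, Fintype.card_piFinset]
    simp
  · simp

/-- The probability that a random function avoids a set of values on `c`. -/
lemma prob_forall_notMem [DecidableEq Ω] [Nonempty Ω] (c : Finset V) (t : Finset Ω) :
    prob (fun g : V → Ω => ∀ v ∈ c, g v ∉ t)
      = (1 - (t.card : ℝ) / Fintype.card Ω) ^ c.card := by
  classical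
  have hpos : (0 : ℝ) < Fintype.card Ω := by exact_mod_cast Fintype.card_pos
  rw [prob_eq_card_div]
  have : (Finset.univ.filter fun g : V → Ω => ∀ v ∈ c, g v ∉ t)
      = Fintype.piFinset fun v => if v ∈ c then tᶜ else Finset.univ := by
    ext g
    simp only [Finset.mem_filter, Finset.mem_univ, true_and, Fintype.mem_piFinset]
    refine forall_congr' fun v => ?_
    by_cases hv : v ∈ c <;> simp [hv]
  rw [this, Fintype.card_piFinset, Fintype.card_fun, ← Finset.card_univ (α := V)]
  push_cast
  rw [← Finset.prod_const, ← Finset.prod_div_distrib, ← Finset.prod_const,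
    ← Finset.prod_subset (Finset.subset_univ c)]
  · refine Finset.prod_congr rfl fun v hv => ?_
    simp only [hv, if_true, Finset.card_compl]
    rw [Nat.cast_sub (Finset.card_le_univ t)]
    field_simp
  · intro v _ hv
    simp only [hv, if_false, Finset.card_univ]
    field_simp

end Functions

/-! ### Images of random functions -/

section Images

variable {V Ω : Type*} [Fintype V] [DecidableEq V] [Fintype Ω] [DecidableEq Ω] [Nonempty Ω]

lemma card_image_eq_sub_sum (c : Finset V) (g : V → Ω) :
    ((c.image g).card : ℝ)
      = Fintype.card Ω - ∑ s : Ω, if (∀ v ∈ c, g v ∉ ({s} : Finset Ω)) then (1 : ℝ) else 0 := by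
  have h : (Finset.univ.filter fun s : Ω => ∀ v ∈ c, g v ∉ ({s} : Finset Ω))
      = (c.image g)ᶜ := by
    ext s
    simp
  rw [Finset.sum_boole, h, Finset.card_compl, Nat.cast_sub (Finset.card_le_univ _)]
  ring

lemma avg_card_image (c : Finset V) :
    avg (fun g : V → Ω => ((c.image g).card : ℝ))
      = Fintype.card Ω * (1 - (1 - 1 / (Fintype.card Ω : ℝ)) ^ c.card) := by
  simp only [card_image_eq_sub_sum]
  rw [avg_sub, avg_const, avg_sum]
  have : ∀ s : Ω, avg (fun g : V → Ω => if (∀ v ∈ c, g v ∉ ({s} : Finset Ω)) then (1 : ℝ) else 0)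
      = (1 - 1 / (Fintype.card Ω : ℝ)) ^ c.card := by
    intro s
    have := prob_forall_notMem (V := V) c ({s} : Finset Ω)
    rw [Finset.card_singleton, Nat.cast_one] at this
    rw [← this, prob_eq_avg]
  rw [Finset.sum_congr rfl fun s _ => this s]
  simp
  ring

/-- The square of the number of missed symbols counts ordered pairs of missed symbols: q diagonal
pairs, each with probability (1 - 1/q)^|c|, and q(q - 1) others, each with probability (1 -
2/q)^|c|. -/
lemma avg_card_image_sq (c : Finset V) :
    avg (fun g : V → Ω => ((c.image g).card : ℝ) ^ 2)
      = (Fintype.card Ω : ℝ) ^ 2 - (2 * Fintype.card Ω - 1) * Fintype.card Ω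
          * (1 - 1 / (Fintype.card Ω : ℝ)) ^ c.card
        + Fintype.card Ω * (Fintype.card Ω - 1) * (1 - 2 / (Fintype.card Ω : ℝ)) ^ c.card := by
  set q : ℝ := (Fintype.card Ω : ℝ) with hq
  set u : (V → Ω) → ℝ :=
    fun g => ∑ s : Ω, if (∀ v ∈ c, g v ∉ ({s} : Finset Ω)) then (1 : ℝ) else 0 with hu
  have hk : ∀ g : V → Ω, ((c.image g).card : ℝ) = q - u g := card_image_eq_sub_sum c
  have h1 : avg u = q * (1 - 1 / q) ^ c.card := by
    have := avg_card_image (Ω := Ω) c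
    simp only [hk] at this
    rw [avg_sub, avg_const] at this
    linarith
  have h2 : avg (fun g => u g ^ 2)
      = q * (1 - 1 / q) ^ c.card + q * (q - 1) * (1 - 2 / q) ^ c.card := by
    have e1 : ∀ g : V → Ω, u g ^ 2 = ∑ s : Ω, ∑ t : Ω,
        if (∀ v ∈ c, g v ∉ ({s, t} : Finset Ω)) then (1 : ℝ) else 0 := by
      intro g
      rw [sq, hu]
      simp only
      rw [Finset.sum_mul_sum]
      refine Finset.sum_congr rfl fun s _ => Finset.sum_congr rfl fun t _ => ?_
      rw [ite_zero_mul_ite_zero, one_mul]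
      refine if_congr ?_ rfl rfl
      rw [← forall₂_and]
      refine forall₂_congr fun v _ => ?_
      simp
    have e2 : ∀ s t : Ω,
        avg (fun g : V → Ω => if (∀ v ∈ c, g v ∉ ({s, t} : Finset Ω)) then (1 : ℝ) else 0)
          = if s = t then (1 - 1 / q) ^ c.card else (1 - 2 / q) ^ c.card := by
      intro s t
      have := prob_forall_notMem (V := V) c ({s, t} : Finset Ω)
      have e3 : avg (fun g : V → Ω => if (∀ v ∈ c, g v ∉ ({s, t} : Finset Ω)) then (1 : ℝ) else 0)
          = prob (fun g : V → Ω => ∀ v ∈ c, g v ∉ ({s, t} : Finset Ω)) := by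
        rw [prob_eq_avg]
      rw [e3, this]
      by_cases hst : s = t
      · simp [hst, hq]
      · rw [Finset.card_pair hst, if_neg hst]
        simp [hq]
    simp only [e1]
    rw [avg_sum]
    simp only [avg_sum, e2]
    have e4 : ∀ s : Ω, (∑ t : Ω, if s = t then (1 - 1 / q) ^ c.card else (1 - 2 / q) ^ c.card)
        = (1 - 1 / q) ^ c.card + (q - 1) * (1 - 2 / q) ^ c.card := by
      intro s
      rw [← Finset.add_sum_erase _ _ (Finset.mem_univ s), if_pos rfl]
      congr 1
      rw [Finset.sum_congr rfl fun t ht => if_neg (Finset.ne_of_mem_erase ht).symm,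
        Finset.sum_const, Finset.card_erase_of_mem (Finset.mem_univ s), nsmul_eq_mul,
        Nat.cast_sub (Finset.card_pos.2 Finset.univ_nonempty), Finset.card_univ]
      simp [hq]
    rw [Finset.sum_congr rfl fun s _ => e4 s, Finset.sum_const, Finset.card_univ, nsmul_eq_mul]
    ring
  have h3 : ∀ g : V → Ω, ((c.image g).card : ℝ) ^ 2 = q ^ 2 - 2 * q * u g + u g ^ 2 := by
    intro g; rw [hk]; ring
  simp only [h3]
  rw [avg_add, avg_sub, avg_const, avg_mul_left, h1, h2]
  ring

lemma image_update_of_notMem {c : Finset V} {y : V} (hy : y ∉ c) (g : V → Ω) (z : Ω) :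
    c.image (Function.update g y z) = c.image g := by
  refine Finset.image_congr fun v hv => ?_
  rw [Function.update_of_ne]
  rintro rfl
  exact hy hv

lemma image_insert_update {c : Finset V} {y : V} (hy : y ∉ c) (g : V → Ω) (z : Ω) :
    (insert y c).image (Function.update g y z) = insert z (c.image g) := by
  rw [Finset.image_insert, image_update_of_notMem hy, Function.update_self]

/-- The probability that adding one vertex to an edge does not change its image. -/
lemma prob_image_insert {c : Finset V} {y : V} (hy : y ∉ c) :
    prob (fun g : V → Ω => c.image g = (insert y c).image g)
      = 1 - (1 - 1 / (Fintype.card Ω : ℝ)) ^ c.card := by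
  have hq : (Fintype.card Ω : ℝ) ≠ 0 := by exact_mod_cast Fintype.card_ne_zero
  -- Given the labels on `c`, the fresh label of `y` is absorbed with probability |image| / q.
  rw [prob_eq_avg, avg_update y]
  simp only [image_update_of_notMem hy, image_insert_update hy]
  have : ∀ g : V → Ω, avg (fun z : Ω => if c.image g = insert z (c.image g) then (1 : ℝ) else 0)
      = ((c.image g).card : ℝ) / Fintype.card Ω := by
    intro g
    rw [← prob_mem, prob_eq_avg]
    simp only [eq_comm (a := c.image g), Finset.insert_eq_self]
  have e : avg (fun g : V → Ω => ((c.image g).card : ℝ) / Fintype.card Ω)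
      = 1 - (1 - 1 / (Fintype.card Ω : ℝ)) ^ c.card := by
    rw [avg_div, avg_card_image, mul_div_cancel_left₀ _ hq]
  rw [← e]
  simp only [this]

/-- With k = |K|, the two insertions agree exactly when z and w both lie in K, or z = w lies
outside: k² + (q - k) of the q² pairs. -/
lemma avg_avg_insert_eq_insert (K : Finset Ω) :
    avg (fun z : Ω => avg fun w : Ω => if insert z K = insert w K then (1 : ℝ) else 0)
      = ((K.card : ℝ) ^ 2 + Fintype.card Ω - K.card) / (Fintype.card Ω : ℝ) ^ 2 := by
  have h1 : ∀ z : Ω, (∑ w : Ω, if insert z K = insert w K then (1 : ℝ) else 0)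
      = if z ∈ K then (K.card : ℝ) else 1 := by
    intro z
    by_cases hz : z ∈ K
    · have : ∀ w : Ω, insert z K = insert w K ↔ w ∈ K := by
        intro w
        rw [Finset.insert_eq_self.2 hz, eq_comm, Finset.insert_eq_self]
      simp only [this, hz, if_true]
      simp
    · have : ∀ w : Ω, insert z K = insert w K ↔ w = z := by
        intro w
        refine ⟨fun h => ?_, fun h => by rw [h]⟩
        have := Finset.mem_insert_self z K
        rw [h, Finset.mem_insert] at this
        rcases this with h | h
        · exact h.symm
        · exact absurd h hz
      simp [this, hz]
  simp only [avg, h1]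
  rw [← Finset.sum_div, div_div, ← sq]
  congr 1
  have h2 : ∀ z : Ω, (if z ∈ K then (K.card : ℝ) else 1)
      = 1 + if z ∈ K then ((K.card : ℝ) - 1) else 0 := by
    intro z; split_ifs <;> ring
  simp only [h2]
  rw [Finset.sum_add_distrib, Finset.sum_ite_mem]
  simp
  ring

/-- The probability that two edges that differ by the exchange of one vertex have the same image. -/
lemma prob_image_insert_insert {c : Finset V} {x y : V} (hx : x ∉ c) (hy : y ∉ c) (hxy : x ≠ y) :
    prob (fun g : V → Ω => (insert x c).image g = (insert y c).image g)
      = 1 - 2 * (1 - 1 / (Fintype.card Ω : ℝ)) ^ (c.card + 1)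
        + (1 - 1 / (Fintype.card Ω : ℝ)) * (1 - 2 / (Fintype.card Ω : ℝ)) ^ c.card := by
  have hq : (Fintype.card Ω : ℝ) ≠ 0 := by exact_mod_cast Fintype.card_ne_zero
  have hyx : y ∉ insert x c := by simp [hy, hxy.symm]
  rw [prob_eq_avg, avg_update y]
  simp only [image_update_of_notMem hyx, image_insert_update hy]
  rw [avg_update x]
  simp only [image_insert_update hx, image_update_of_notMem hx]
  have e : avg (fun g : V → Ω => (((c.image g).card : ℝ) ^ 2 + Fintype.card Ω - (c.image g).card)
        / (Fintype.card Ω : ℝ) ^ 2)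
      = 1 - 2 * (1 - 1 / (Fintype.card Ω : ℝ)) ^ (c.card + 1)
        + (1 - 1 / (Fintype.card Ω : ℝ)) * (1 - 2 / (Fintype.card Ω : ℝ)) ^ c.card := by
    rw [avg_div, avg_sub, avg_add, avg_const, avg_card_image, avg_card_image_sq, pow_succ _ c.card]
    generalize (1 - 1 / (Fintype.card Ω : ℝ)) ^ c.card = r
    generalize (1 - 2 / (Fintype.card Ω : ℝ)) ^ c.card = s
    field_simp
    ring
  rw [← e]
  simp only [avg_avg_insert_eq_insert]

/-- With k = |K|, there are at most k² solutions if T = K, at most 2k + 1 ≤ k² + 2 if T has one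
element more, at most 2 for any larger T ⊇ K, and none otherwise. The bound does not depend on T,
which later is the image of an arbitrary edge. -/
lemma card_insert_insert_eq_le (K T : Finset Ω) :
    (Finset.univ.filter fun p : Ω × Ω => insert p.2 (insert p.1 K) = T).card ≤ K.card ^ 2 + 2 := by
  by_cases h0 : T = K
  · subst h0
    have : (Finset.univ.filter fun p : Ω × Ω => insert p.2 (insert p.1 T) = T) ⊆ T ×ˢ T := by
      rintro ⟨a, b⟩ h
      simp only [Finset.mem_filter, Finset.mem_univ, true_and] at h
      rw [Finset.mem_product]
      constructor
      · rw [← h]; simp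
      · rw [← h]; simp
    calc _ ≤ (T ×ˢ T).card := Finset.card_le_card this
      _ ≤ _ := by rw [Finset.card_product, sq]; omega
  by_cases hKT : K ⊆ T
  · obtain ⟨t, htT, htK⟩ : ∃ t ∈ T, t ∉ K := by
      by_contra! h
      exact h0 (Finset.Subset.antisymm h hKT)
    by_cases h1 : T = insert t K
    · have : (Finset.univ.filter fun p : Ω × Ω => insert p.2 (insert p.1 K) = T)
          ⊆ ({t} ×ˢ insert t K) ∪ (K ×ˢ {t}) := by
        rintro ⟨a, b⟩ h
        simp only [Finset.mem_filter, Finset.mem_univ, true_and] at h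
        have ha : a ∈ insert t K := by rw [← h1, ← h]; simp
        have hb : b ∈ insert t K := by rw [← h1, ← h]; simp
        have ht : t ∈ insert b (insert a K) := by rw [h]; exact htT
        simp only [Finset.mem_insert, Finset.mem_union, Finset.mem_product,
          Finset.mem_singleton] at ha hb ht ⊢
        rcases ht with rfl | rfl | ht
        · rcases ha with rfl | ha
          · simp
          · simp [ha]
        · simp [hb]
        · exact absurd ht htK
      have hc := (Finset.card_le_card this).trans (Finset.card_union_le _ _)
      rw [Finset.card_product, Finset.card_product, Finset.card_insert_of_notMem htK,
        Finset.card_singleton] at hc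
      refine hc.trans ?_
      rcases Nat.lt_or_ge K.card 3 with hk | hk
      · interval_cases K.card <;> simp
      · nlinarith
    · obtain ⟨t', ht'T, ht'K⟩ : ∃ t' ∈ T, t' ∉ insert t K := by
        by_contra! h
        exact h1 (Finset.Subset.antisymm h (Finset.insert_subset htT hKT))
      have : (Finset.univ.filter fun p : Ω × Ω => insert p.2 (insert p.1 K) = T)
          ⊆ {(t, t'), (t', t)} := by
        rintro ⟨a, b⟩ h
        simp only [Finset.mem_filter, Finset.mem_univ, true_and] at h
        rw [← h] at htT ht'T
        simp only [Finset.mem_insert, Finset.mem_singleton, Prod.mk.injEq] at *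
        grind
      calc _ ≤ _ := Finset.card_le_card this
        _ ≤ 2 := Finset.card_le_two
        _ ≤ _ := by omega
  · have : (Finset.univ.filter fun p : Ω × Ω => insert p.2 (insert p.1 K) = T) = ∅ := by
      refine Finset.filter_eq_empty_iff.2 fun p _ h => hKT ?_
      rw [← h]
      exact (Finset.subset_insert _ _).trans (Finset.subset_insert _ _)
    simp [this]

/-- A bound for the probability that two edges have the same image when one of them contains two
vertices outside the other. -/
lemma prob_image_insert_insert_le {c e : Finset V} {x y : V} (hx : x ∉ c) (hy : y ∉ c)
    (hxy : x ≠ y) (hxe : x ∉ e) (hye : y ∉ e) :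
    prob (fun g : V → Ω => e.image g = (insert y (insert x c)).image g)
      ≤ 1 - (2 - 1 / (Fintype.card Ω : ℝ)) * (1 - 1 / (Fintype.card Ω : ℝ)) ^ c.card
        + (1 - 1 / (Fintype.card Ω : ℝ)) * (1 - 2 / (Fintype.card Ω : ℝ)) ^ c.card
        + 2 / (Fintype.card Ω : ℝ) ^ 2 := by
  have hq : (Fintype.card Ω : ℝ) ≠ 0 := by exact_mod_cast Fintype.card_ne_zero
  have hyx : y ∉ insert x c := by simp [hy, hxy.symm]
  -- Resampling `x` and `y` leaves the images of `c` and `e` alone, so the count above applies for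
  -- each fixed pair of images.
  rw [prob_eq_avg, avg_update y]
  simp only [image_update_of_notMem hye, image_insert_update hyx]
  rw [avg_update x]
  simp only [image_insert_update hx, image_update_of_notMem hxe]
  have hE : avg (fun g : V → Ω => (((c.image g).card : ℝ) ^ 2 + 2) / (Fintype.card Ω : ℝ) ^ 2)
      = 1 - (2 - 1 / (Fintype.card Ω : ℝ)) * (1 - 1 / (Fintype.card Ω : ℝ)) ^ c.card
        + (1 - 1 / (Fintype.card Ω : ℝ)) * (1 - 2 / (Fintype.card Ω : ℝ)) ^ c.card
        + 2 / (Fintype.card Ω : ℝ) ^ 2 := by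
    rw [avg_div, avg_add, avg_const, avg_card_image_sq]
    generalize (1 - 1 / (Fintype.card Ω : ℝ)) ^ c.card = r
    generalize (1 - 2 / (Fintype.card Ω : ℝ)) ^ c.card = s
    field_simp
  rw [← hE]
  refine avg_mono fun g => ?_
  have h := card_insert_insert_eq_le (c.image g) (e.image g)
  have h' := prob_eq_card_div fun p : Ω × Ω => insert p.2 (insert p.1 (c.image g)) = e.image g
  have h'' : prob (fun p : Ω × Ω => e.image g = insert p.2 (insert p.1 (c.image g)))
      ≤ (((c.image g).card : ℝ) ^ 2 + 2) / (Fintype.card Ω : ℝ) ^ 2 := by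
    simp only [eq_comm (a := e.image g)]
    rw [h', Fintype.card_prod, Nat.cast_mul, ← sq]
    gcongr
    exact_mod_cast h
  rw [prob_eq_avg, avg_prod] at h''
  exact h''

end Images

/-! ### Random functions without conflicts -/

section ConflictFree

lemma prob_not {α : Type*} [Fintype α] [Nonempty α] (p : α → Prop) :
    prob (fun a => ¬ p a) = 1 - prob p := by
  classical
  rw [prob_eq_avg, prob_eq_avg, ← avg_const (α := α) 1, ← avg_sub]
  congr 1
  funext a
  by_cases h : p a <;> simp [h, avg_const]

lemma prob_or_le {α : Type*} [Fintype α] (p q : α → Prop) :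
    prob (fun a => p a ∨ q a) ≤ prob p + prob q := by
  classical
  rw [prob_eq_avg, prob_eq_avg, prob_eq_avg, ← avg_add]
  refine avg_mono fun a => ?_
  by_cases h : p a <;> by_cases h' : q a <;> simp [h, h']

lemma prob_exists_le {α ι : Type*} [Fintype α] (s : Finset ι) (p : ι → α → Prop) :
    prob (fun a => ∃ i ∈ s, p i a) ≤ ∑ i ∈ s, prob (p i) := by
  classical
  simp only [prob_eq_avg]
  rw [← avg_sum]
  refine avg_mono fun a => ?_
  split_ifs with h
  · obtain ⟨i, hi, hp⟩ := h
    have := Finset.single_le_sum (f := fun i => if p i a then (1 : ℝ) else 0)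
      (fun j _ => by split_ifs <;> norm_num) hi
    simpa [hp] using this
  · exact Finset.sum_nonneg fun j _ => by split_ifs <;> norm_num

variable {V Ω ι : Type*} [Fintype V] [DecidableEq V] [Fintype Ω] [Nonempty Ω]

/-- The labels on `A` have few conflicts with other labels and none with each other. -/
def ConflictFreeOn (R : Ω → Ω → Prop) (n : ℕ) (A : Finset V) (g : V → Ω) : Prop :=
  (∀ x ∈ A, prob (R (g x)) ≤ 1 / (4 * n)) ∧ ∀ x ∈ A, ∀ y ∈ A, x ≠ y → ¬ R (g x) (g y)

/-- Markov's inequality: the mean conflict probability is at most 1/(8n), half of the threshold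
1/(4n). -/
lemma prob_conflict_gt_le {R : Ω → Ω → Prop} {n : ℕ} (hn : 0 < n)
    (hR : 8 * n * prob (fun p : Ω × Ω => R p.1 p.2) ≤ 1) :
    prob (fun z => ¬ prob (R z) ≤ 1 / (4 * n)) ≤ 1 / 2 := by
  classical
  have hn' : (0 : ℝ) < n := by exact_mod_cast hn
  have h1 : prob (fun p : Ω × Ω => R p.1 p.2) = avg fun z => prob (R z) := by
    rw [prob_eq_avg, avg_prod]
    simp only [prob_eq_avg]
  have h2 : prob (fun z => ¬ prob (R z) ≤ 1 / (4 * n)) * (1 / (4 * n))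
      ≤ avg fun z => prob (R z) := by
    rw [prob_eq_avg, ← avg_mul_right]
    refine avg_mono fun z => ?_
    split_ifs with h
    · simpa using prob_nonneg (R z)
    · rw [one_mul]
      exact (not_le.1 h).le
  rw [← h1] at h2
  rw [mul_one_div, div_le_iff₀ (by positivity)] at h2
  nlinarith

/-- A fresh label for `v` has too many conflicts with probability at most 1/2, and conflicts with
one of the at most n labels on `A` with probability at most n · 1/(4n) = 1/4. So at least a quarter
of the labels extend a conflict-free labelling. -/
lemma prob_conflictFreeOn_le {R : Ω → Ω → Prop} (hsymm : ∀ z w, R z w → R w z) {n : ℕ}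
    (hn : 0 < n) (hR : 8 * n * prob (fun p : Ω × Ω => R p.1 p.2) ≤ 1) {A : Finset V}
    (hA : A.card ≤ n) {v : V} (hv : v ∉ A) :
    prob (ConflictFreeOn R n A) ≤ 4 * prob (ConflictFreeOn R n (insert v A)) := by
  classical
  have hn' : (0 : ℝ) < n := by exact_mod_cast hn
  rw [prob_eq_avg, prob_eq_avg, avg_update v fun g : V → Ω => if ConflictFreeOn R n (insert v A) g
    then (1 : ℝ) else 0, ← avg_mul_left]
  refine avg_mono fun g => ?_
  rw [← prob_eq_avg fun z => ConflictFreeOn R n (insert v A) (Function.update g v z)]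
  split_ifs with hg
  swap
  · exact mul_nonneg (by norm_num) (prob_nonneg _)
  have h1 : prob (fun z => ¬ ConflictFreeOn R n (insert v A) (Function.update g v z))
      ≤ prob (fun z => ¬ prob (R z) ≤ 1 / (4 * n) ∨ ∃ w ∈ A, R (g w) z) := by
    refine prob_mono fun z hz => ?_
    by_contra! hcon
    refine hz ⟨fun x hx => ?_, fun x hx y hy hxy => ?_⟩
    · by_cases hxv : x = v
      · subst hxv; simpa using hcon.1
      · rw [Function.update_of_ne hxv]
        exact hg.1 x (Finset.mem_of_mem_insert_of_ne hx hxv)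
    · by_cases hxv : x = v
      · subst hxv
        rw [Function.update_self, Function.update_of_ne hxy.symm]
        exact fun h => hcon.2 y (Finset.mem_of_mem_insert_of_ne hy hxy.symm) (hsymm _ _ h)
      · by_cases hyv : y = v
        · subst hyv
          rw [Function.update_self, Function.update_of_ne hxy]
          exact hcon.2 x (Finset.mem_of_mem_insert_of_ne hx hxy)
        · rw [Function.update_of_ne hxv, Function.update_of_ne hyv]
          exact hg.2 x (Finset.mem_of_mem_insert_of_ne hx hxv) y
            (Finset.mem_of_mem_insert_of_ne hy hyv) hxy
  have h2 : ∑ w ∈ A, prob (R (g w)) ≤ 1 / 4 := by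
    calc ∑ w ∈ A, prob (R (g w)) ≤ ∑ _w ∈ A, 1 / (4 * (n : ℝ)) :=
          Finset.sum_le_sum fun w hw => hg.1 w hw
      _ = A.card * (1 / (4 * (n : ℝ))) := by simp
      _ ≤ n * (1 / (4 * (n : ℝ))) := by gcongr
      _ = 1 / 4 := by field_simp
  have h3 := (h1.trans (prob_or_le _ _)).trans
    (add_le_add (prob_conflict_gt_le hn hR) ((prob_exists_le A fun w z => R (g w) z).trans h2))
  rw [prob_not] at h3
  linarith

/-- Restoring the vertices of `T` one at a time costs a factor 4 each. Freeing `T` makes the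
condition independent of events on `T`. -/
lemma prob_conflictFreeOn_sdiff_le {R : Ω → Ω → Prop} (hsymm : ∀ z w, R z w → R w z) {n : ℕ}
    (hn : 0 < n) (hR : 8 * n * prob (fun p : Ω × Ω => R p.1 p.2) ≤ 1) {A : Finset V}
    (hA : A.card ≤ n) (T : Finset V) :
    prob (ConflictFreeOn R n (A \ T)) ≤ 4 ^ T.card * prob (ConflictFreeOn R n A) := by
  classical
  induction T using Finset.induction_on with
  | empty => simp
  | insert v T hv ih =>
    rw [Finset.card_insert_of_notMem hv, pow_succ']
    by_cases hvA : v ∈ A \ T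
    · have h1 : insert v (A \ insert v T) = A \ T := by
        ext x
        simp only [Finset.mem_insert, Finset.mem_sdiff] at hvA ⊢
        grind
      have h2 := prob_conflictFreeOn_le hsymm hn hR
        ((Finset.card_le_card (Finset.sdiff_subset (s := A) (t := insert v T))).trans hA)
        (v := v) (by simp)
      rw [h1] at h2
      linarith
    · have h1 : A \ insert v T = A \ T := by
        ext x
        simp only [Finset.mem_insert, Finset.mem_sdiff] at hvA ⊢
        grind
      rw [h1]
      have := mul_nonneg (pow_nonneg (by norm_num : (0 : ℝ) ≤ 4) T.card)
        (prob_nonneg (ConflictFreeOn R n A))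
      nlinarith

/-- If conflicts between labels are rare, then a labelling without conflicts can avoid any family
of events that depend on few coordinates each and whose total probability is small. -/
lemma exists_conflictFree {R : Ω → Ω → Prop} (hsymm : ∀ z w, R z w → R w z) {n : ℕ} (hn : 0 < n)
    (hR : 8 * n * prob (fun p : Ω × Ω => R p.1 p.2) ≤ 1) {A : Finset V} (hA : A.card ≤ n)
    (I : Finset ι) (T : ι → Finset V) {k : ℕ} (hT : ∀ i ∈ I, (T i).card ≤ k)
    (p : ι → (V → Ω) → Prop)
    (hp : ∀ i ∈ I, ∀ g g', (∀ v ∈ T i, g v = g' v) → (p i g ↔ p i g'))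
    (hsum : ∑ i ∈ I, 4 ^ k * prob (p i) < 1) :
    ∃ g : V → Ω, (∀ x ∈ A, ∀ y ∈ A, x ≠ y → ¬ R (g x) (g y)) ∧ ∀ i ∈ I, ¬ p i g := by
  classical
  -- Freeing all of `A` leaves an empty condition of probability 1.
  have hpos : 0 < prob (ConflictFreeOn R n A) := by
    have h := prob_conflictFreeOn_sdiff_le hsymm hn hR hA A
    rw [sdiff_self] at h
    have h1 : prob (ConflictFreeOn R n (∅ : Finset V)) = 1 := by
      rw [← avg_const (α := V → Ω) 1, prob_eq_avg]
      congr 1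
      funext g
      rw [if_pos]
      exact ⟨by simp, by simp⟩
    rw [Finset.bot_eq_empty, h1] at h
    by_contra! hneg
    have := mul_nonpos_of_nonneg_of_nonpos (pow_nonneg (by norm_num : (0 : ℝ) ≤ 4) A.card) hneg
    linarith
  have hi : ∀ i ∈ I, prob (fun g => ConflictFreeOn R n A g ∧ p i g)
      ≤ 4 ^ k * prob (p i) * prob (ConflictFreeOn R n A) := by
    intro i hi
    -- Dropping the condition on `T i` gives independence from `p i`, at the price of the factor
    -- 4^k.
    have h1 : prob (fun g => ConflictFreeOn R n A g ∧ p i g)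
        ≤ prob (fun g => p i g ∧ ConflictFreeOn R n (A \ T i) g) := by
      refine prob_mono fun g hg => ⟨hg.2, fun x hx => hg.1.1 x (Finset.mem_sdiff.1 hx).1,
        fun x hx y hy => hg.1.2 x (Finset.mem_sdiff.1 hx).1 y (Finset.mem_sdiff.1 hy).1⟩
    have h2 : prob (fun g => p i g ∧ ConflictFreeOn R n (A \ T i) g)
        = prob (p i) * prob (ConflictFreeOn R n (A \ T i)) := by
      refine prob_and_of_dependsOn (T i) _ _ (hp i hi) fun g g' h => ?_
      unfold ConflictFreeOn
      have h' : ∀ x ∈ A \ T i, g x = g' x := fun x hx => h x (Finset.mem_sdiff.1 hx).2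
      refine and_congr (forall₂_congr fun x hx => by rw [h' x hx])
        (forall₂_congr fun x hx => forall₂_congr fun y hy => by rw [h' x hx, h' y hy])
    rw [h2] at h1
    refine h1.trans ?_
    have h3 := prob_conflictFreeOn_sdiff_le hsymm hn hR hA (T i)
    have h4 : (4 : ℝ) ^ (T i).card ≤ 4 ^ k := pow_le_pow_right₀ (by norm_num) (hT i hi)
    have h5 : prob (ConflictFreeOn R n (A \ T i)) ≤ 4 ^ k * prob (ConflictFreeOn R n A) :=
      h3.trans (mul_le_mul_of_nonneg_right h4 hpos.le)
    calc _ ≤ prob (p i) * (4 ^ k * prob (ConflictFreeOn R n A)) :=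
          mul_le_mul_of_nonneg_left h5 (prob_nonneg _)
      _ = _ := by ring
  have hlt : prob (fun g => ∃ i ∈ I, ConflictFreeOn R n A g ∧ p i g)
      < prob (ConflictFreeOn R n A) := by
    refine (prob_exists_le I _).trans_lt ((Finset.sum_le_sum hi).trans_lt ?_)
    rw [← Finset.sum_mul]
    exact mul_lt_of_lt_one_left hpos hsum
  -- Otherwise every conflict-free labelling would meet one of the events, against `hlt`.
  by_contra! hcon
  refine absurd hlt (not_lt.2 (prob_mono fun g hg => ?_))
  obtain ⟨i, hi, hpi⟩ := hcon g hg.2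
  exact ⟨i, hi, hg, hpi⟩

end ConflictFree

/-! ### Separating families of tests -/

section Labelling

variable {V : Type*} [Fintype V] [DecidableEq V]

/-- There are `N` tests whose results distinguish any two members of `E`. -/
def Separable (E : Finset (Finset V)) (N : ℕ) : Prop :=
  ∃ t : Fin N → Finset V, ∀ e ∈ E, ∀ e' ∈ E,
    (∀ i, (t i ∩ e).Nonempty ↔ (t i ∩ e').Nonempty) → e = e'

lemma separable_of_fintype {ι : Type*} [Fintype ι] {E : Finset (Finset V)} (t : ι → Finset V)
    (ht : ∀ e ∈ E, ∀ e' ∈ E, (∀ i, (t i ∩ e).Nonempty ↔ (t i ∩ e').Nonempty) → e = e') :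
    Separable E (Fintype.card ι) :=
  ⟨fun i => t ((Fintype.equivFin ι).symm i), fun e he e' he' h => ht e he e' he' fun i => by
    simpa using h (Fintype.equivFin ι i)⟩

variable {B Q : ℕ}

/-- In every coordinate, `e` and `e'` carry the same set of labels. -/
def Confused (e e' : Finset V) (l : V → Fin B → Fin Q) : Prop :=
  ∀ j, e.image (fun v => l v j) = e'.image (fun v => l v j)

lemma Confused.symm {e e' : Finset V} {l : V → Fin B → Fin Q} (h : Confused e e' l) :
    Confused e' e l := fun j => (h j).symm

/-- Test (j, s) examines the vertices with j-th label s, so the results spell out the label set of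
the edge in each coordinate. -/
lemma separable_of_labelling {E : Finset (Finset V)} (l : V → Fin B → Fin Q)
    (hl : ∀ e ∈ E, ∀ e' ∈ E, e ≠ e' → ¬ Confused e e' l) : Separable E (B * Q) := by
  have h := separable_of_fintype (E := E)
    (fun i : Fin B × Fin Q => Finset.univ.filter fun v => l v i.1 = i.2) ?_
  · simpa using h
  · intro e he e' he' h
    by_contra hne
    refine hl e he e' he' hne fun j => ?_
    ext s
    have := h (j, s)
    simp only [Finset.Nonempty, Finset.mem_inter, Finset.mem_filter, Finset.mem_univ,
      true_and] at this
    simp only [Finset.mem_image]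
    constructor
    · rintro ⟨v, hv, hs⟩
      obtain ⟨w, hw⟩ := this.1 ⟨v, hs, hv⟩
      exact ⟨w, hw.2, hw.1⟩
    · rintro ⟨v, hv, hs⟩
      obtain ⟨w, hw⟩ := this.2 ⟨v, hs, hv⟩
      exact ⟨w, hw.2, hw.1⟩

lemma prob_confused (e e' : Finset V) :
    prob (fun l : V → Fin B → Fin Q => Confused e e' l)
      = prob (fun g : V → Fin Q => e.image g = e'.image g) ^ B :=
  prob_forall_row B fun g : V → Fin Q => e.image g = e'.image g

end Labelling

/-! ### The probability that two edges are confused -/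

section Bounds

/-- The probability, in one coordinate, that an edge of size `d` is confused with the edge that
arises by deletion of one vertex. -/
noncomputable def deletionProb (d Q : ℕ) : ℝ := 1 - (1 - 1 / (Q : ℝ)) ^ (d - 1)

/-- The probability, in one coordinate, that two edges of size `d` which differ by the exchange of
one vertex are confused. -/
noncomputable def exchangeProb (d Q : ℕ) : ℝ :=
  1 - 2 * (1 - 1 / (Q : ℝ)) ^ d + (1 - 1 / (Q : ℝ)) * (1 - 2 / (Q : ℝ)) ^ (d - 1)

/-- A bound for the probability, in one coordinate, that an edge is confused with an edge of size
`d` which has two further vertices. -/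
noncomputable def remoteProb (d Q : ℕ) : ℝ :=
  1 - (2 - 1 / (Q : ℝ)) * (1 - 1 / (Q : ℝ)) ^ (d - 2)
    + (1 - 1 / (Q : ℝ)) * (1 - 2 / (Q : ℝ)) ^ (d - 2) + 2 / (Q : ℝ) ^ 2

/-- With x = 1/Q the increment is 2x(1 - x)((1 - x)^s - (1 - 2x)^s) ≥ 0. Hence edges of size exactly
d are the worst case. -/
lemma exchange_mono {Q : ℕ} (hQ : 2 ≤ Q) :
    Monotone fun s : ℕ => 1 - 2 * (1 - 1 / (Q : ℝ)) ^ (s + 1)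
      + (1 - 1 / (Q : ℝ)) * (1 - 2 / (Q : ℝ)) ^ s := by
  refine monotone_nat_of_le_succ fun s => ?_
  have hQ' : (2 : ℝ) ≤ Q := by exact_mod_cast hQ
  have hx : 0 ≤ 1 / (Q : ℝ) := by positivity
  have hx' : 1 / (Q : ℝ) ≤ 1 / 2 := one_div_le_one_div_of_le (by norm_num) hQ'
  rw [show (2 : ℝ) / Q = 2 * (1 / Q) by ring]
  generalize 1 / (Q : ℝ) = x at hx hx'
  have h1 : (1 - 2 * x) ^ s ≤ (1 - x) ^ s := pow_le_pow_left₀ (by linarith) (by linarith) s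
  have h2 : 0 ≤ 2 * x * (1 - x) * ((1 - x) ^ s - (1 - 2 * x) ^ s) :=
    mul_nonneg (mul_nonneg (by linarith) (by linarith)) (by linarith)
  simp only [pow_succ]
  nlinarith

/-- The increment is that of `exchange_mono` plus x²(1 - x)^s, where x = 1/Q. -/
lemma remote_mono {Q : ℕ} (hQ : 2 ≤ Q) :
    Monotone fun s : ℕ => 1 - (2 - 1 / (Q : ℝ)) * (1 - 1 / (Q : ℝ)) ^ s
      + (1 - 1 / (Q : ℝ)) * (1 - 2 / (Q : ℝ)) ^ s + 2 / (Q : ℝ) ^ 2 := by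
  refine monotone_nat_of_le_succ fun s => ?_
  have hQ' : (2 : ℝ) ≤ Q := by exact_mod_cast hQ
  have hx : 0 ≤ 1 / (Q : ℝ) := by positivity
  have hx' : 1 / (Q : ℝ) ≤ 1 / 2 := one_div_le_one_div_of_le (by norm_num) hQ'
  rw [show (2 : ℝ) / Q = 2 * (1 / Q) by ring]
  generalize 2 / (Q : ℝ) ^ 2 = y
  generalize 1 / (Q : ℝ) = x at hx hx'
  have h0 : 0 ≤ (1 - x) ^ s := pow_nonneg (by linarith) s
  have h1 : (1 - 2 * x) ^ s ≤ (1 - x) ^ s := pow_le_pow_left₀ (by linarith) (by linarith) s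
  have h2 : 0 ≤ 2 * x * (1 - x) * ((1 - x) ^ s - (1 - 2 * x) ^ s) :=
    mul_nonneg (mul_nonneg (by linarith) (by linarith)) (by linarith)
  have h3 : 0 ≤ x * (x * (1 - x) ^ s) := mul_nonneg hx (mul_nonneg hx h0)
  simp only [pow_succ]
  nlinarith

variable {V : Type*} [Fintype V] [DecidableEq V] {B Q d : ℕ}

lemma deletionProb_nonneg (hQ : 2 ≤ Q) : 0 ≤ deletionProb d Q := by
  have hQ' : (2 : ℝ) ≤ Q := by exact_mod_cast hQ
  have hx : 0 ≤ 1 / (Q : ℝ) := by positivity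
  have hx' : 1 / (Q : ℝ) ≤ 1 / 2 := one_div_le_one_div_of_le (by norm_num) hQ'
  have := pow_le_one₀ (n := d - 1) (by linarith : 0 ≤ 1 - 1 / (Q : ℝ)) (by linarith)
  unfold deletionProb
  linarith

lemma exchangeProb_nonneg (hQ : 2 ≤ Q) (hd : 1 ≤ d) : 0 ≤ exchangeProb d Q := by
  have h := exchange_mono hQ (Nat.zero_le (d - 1))
  simp only [Nat.sub_add_cancel hd] at h
  refine le_trans ?_ h
  have hQ' : (2 : ℝ) ≤ Q := by exact_mod_cast hQ
  have hx : 0 ≤ 1 / (Q : ℝ) := by positivity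
  rw [zero_add, pow_one, pow_zero]
  linarith

lemma remoteProb_nonneg (hQ : 2 ≤ Q) : 0 ≤ remoteProb d Q := by
  refine le_trans ?_ (remote_mono hQ (Nat.zero_le (d - 2)))
  have hx : 0 ≤ 2 / (Q : ℝ) ^ 2 := by positivity
  simp only [pow_zero]
  linarith

lemma prob_confused_deletion_le (hQ : 2 ≤ Q) {c : Finset V} {y : V} (hy : y ∉ c)
    (hc : (insert y c).card ≤ d) :
    prob (fun l : V → Fin B → Fin Q => Confused c (insert y c) l) ≤ deletionProb d Q ^ B := by
  have : NeZero Q := ⟨by omega⟩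
  rw [prob_confused]
  refine pow_le_pow_left₀ (prob_nonneg _) ?_ B
  rw [prob_image_insert hy, Fintype.card_fin, deletionProb]
  rw [Finset.card_insert_of_notMem hy] at hc
  have hQ' : (2 : ℝ) ≤ Q := by exact_mod_cast hQ
  have hx : 0 ≤ 1 / (Q : ℝ) := by positivity
  have hx' : 1 / (Q : ℝ) ≤ 1 / 2 := one_div_le_one_div_of_le (by norm_num) hQ'
  have := pow_le_pow_of_le_one (by linarith : 0 ≤ 1 - 1 / (Q : ℝ)) (by linarith)
    (show c.card ≤ d - 1 by omega)
  linarith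

lemma prob_confused_exchange_le (hQ : 2 ≤ Q) {c : Finset V} {x y : V} (hx : x ∉ c) (hy : y ∉ c)
    (hxy : x ≠ y) (hc : (insert x c).card ≤ d) :
    prob (fun l : V → Fin B → Fin Q => Confused (insert x c) (insert y c) l)
      ≤ exchangeProb d Q ^ B := by
  have : NeZero Q := ⟨by omega⟩
  rw [prob_confused]
  refine pow_le_pow_left₀ (prob_nonneg _) ?_ B
  rw [prob_image_insert_insert hx hy hxy, Fintype.card_fin, exchangeProb]
  rw [Finset.card_insert_of_notMem hx] at hc
  have h := exchange_mono hQ (show c.card ≤ d - 1 by omega)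
  simpa only [Nat.sub_add_cancel (show 1 ≤ d by omega)] using h

lemma prob_confused_remote_le (hQ : 2 ≤ Q) {e e' : Finset V} (hd : e'.card ≤ d)
    (he : 2 ≤ (e' \ e).card) :
    prob (fun l : V → Fin B → Fin Q => Confused e e' l) ≤ remoteProb d Q ^ B := by
  have : NeZero Q := ⟨by omega⟩
  rw [prob_confused]
  refine pow_le_pow_left₀ (prob_nonneg _) ?_ B
  obtain ⟨x, hx, y, hy, hxy⟩ := Finset.one_lt_card.1 he
  rw [Finset.mem_sdiff] at hx hy
  have hc : insert y (insert x ((e'.erase x).erase y)) = e' := by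
    ext v
    simp only [Finset.mem_insert, Finset.mem_erase]
    grind
  have hcard : ((e'.erase x).erase y).card + 2 ≤ d := by
    rw [Finset.card_erase_of_mem (by simp [hy.1, hxy.symm]), Finset.card_erase_of_mem hx.1]
    have : 2 ≤ e'.card := he.trans (Finset.card_le_card Finset.sdiff_subset)
    omega
  have h := prob_image_insert_insert_le (Ω := Fin Q) (c := (e'.erase x).erase y) (e := e)
    (by simp) (by simp) hxy hx.2 hy.2
  rw [hc, Fintype.card_fin] at h
  exact h.trans (remote_mono hQ (show ((e'.erase x).erase y).card ≤ d - 2 by omega))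

end Bounds

/-! ### Counting pairs of edges -/

section Pairs

variable {V : Type*} [DecidableEq V]

/-- `e'` arises from `e` by insertion of one vertex. -/
def IsInsertion (e e' : Finset V) : Prop := ∃ y, y ∉ e ∧ e' = insert y e

/-- `e'` arises from `e` by the exchange of one vertex. -/
def IsExchange (e e' : Finset V) : Prop :=
  ∃ c x y, x ∉ c ∧ y ∉ c ∧ x ≠ y ∧ e = insert x c ∧ e' = insert y c

/-- If both differences have at most one element, their sizes (0,1), (1,0), (1,1) are the three near
cases. -/
lemma pair_cases {e e' : Finset V} (h : e ≠ e') :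
    IsInsertion e e' ∨ IsInsertion e' e ∨ IsExchange e e' ∨ 2 ≤ (e' \ e).card
      ∨ 2 ≤ (e \ e').card := by
  by_cases h1 : 2 ≤ (e' \ e).card
  · tauto
  by_cases h2 : 2 ≤ (e \ e').card
  · tauto
  rcases Nat.lt_or_ge (e' \ e).card 1 with h3 | h3
  · have h3' : e' ⊆ e := by
      rw [← Finset.sdiff_eq_empty_iff_subset, ← Finset.card_eq_zero]; omega
    rcases Nat.lt_or_ge (e \ e').card 1 with h4 | h4
    · refine absurd (Finset.Subset.antisymm ?_ h3') h
      rw [← Finset.sdiff_eq_empty_iff_subset, ← Finset.card_eq_zero]; omega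
    · obtain ⟨x, hx⟩ := Finset.card_eq_one.1 (show (e \ e').card = 1 by omega)
      refine Or.inr (Or.inl ⟨x, ?_, ?_⟩)
      · have := Finset.mem_singleton_self x
        rw [← hx, Finset.mem_sdiff] at this
        exact this.2
      · rw [Finset.insert_eq, ← hx, Finset.sdiff_union_of_subset h3']
  · obtain ⟨y, hy⟩ := Finset.card_eq_one.1 (show (e' \ e).card = 1 by omega)
    have hy' := Finset.mem_singleton_self y
    rw [← hy, Finset.mem_sdiff] at hy'
    rcases Nat.lt_or_ge (e \ e').card 1 with h4 | h4
    · have h4' : e ⊆ e' := by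
        rw [← Finset.sdiff_eq_empty_iff_subset, ← Finset.card_eq_zero]; omega
      refine Or.inl ⟨y, hy'.2, ?_⟩
      rw [Finset.insert_eq, ← hy, Finset.sdiff_union_of_subset h4']
    · obtain ⟨x, hx⟩ := Finset.card_eq_one.1 (show (e \ e').card = 1 by omega)
      have hx' := Finset.mem_singleton_self x
      rw [← hx, Finset.mem_sdiff] at hx'
      refine Or.inr (Or.inr (Or.inl ⟨e ∩ e', x, y, ?_, ?_, ?_, ?_, ?_⟩))
      · simp [hx'.2]
      · simp [hy'.2]
      · rintro rfl; exact hx'.2 hy'.1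
      · rw [Finset.insert_eq, ← hx, Finset.sdiff_union_inter]
      · rw [Finset.insert_eq, ← hy, Finset.inter_comm, Finset.sdiff_union_inter]

open Classical in
/-- The number of pairs of members of `E` such that the second one has one vertex more. -/
noncomputable def insertionCount (E : Finset (Finset V)) : ℕ :=
  ((E ×ˢ E).filter fun p => IsInsertion p.1 p.2).card

/-- Such a pair is determined by its larger edge and the inserted vertex. This suffices when d is
fixed. -/
lemma insertionCount_le_mul {E : Finset (Finset V)} {d : ℕ} (hd : ∀ e ∈ E, e.card ≤ d) :
    insertionCount E ≤ E.card * d := by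
  classical
  have h : ((E ×ˢ E).filter fun p => IsInsertion p.1 p.2)
      ⊆ (E.sigma fun e => e).image fun p : Σ _ : Finset V, V => (p.1.erase p.2, p.1) := by
    rintro ⟨e, e'⟩ h
    simp only [Finset.mem_filter, Finset.mem_product] at h
    obtain ⟨⟨-, he'⟩, y, hy, rfl⟩ := h
    simp only [Finset.mem_image, Finset.mem_sigma]
    exact ⟨⟨insert y e, y⟩, ⟨he', Finset.mem_insert_self _ _⟩, by simp [hy]⟩
  have h1 := (Finset.card_le_card h).trans Finset.card_image_le
  rw [Finset.card_sigma] at h1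
  have h2 := h1.trans (Finset.sum_le_card_nsmul E _ d hd)
  rw [smul_eq_mul] at h2
  unfold insertionCount
  convert h2

variable [Fintype V] {B Q d : ℕ}

/-- The union bound over a family of pairs of edges. -/
lemma sum_prob_confused_le (hQ : 2 ≤ Q) (hd1 : 1 ≤ d) {E : Finset (Finset V)}
    (hd : ∀ e ∈ E, e.card ≤ d) (P : Finset (Finset V × Finset V)) (hP : P ⊆ E.offDiag) {n : ℕ}
    (hn : ∀ X ⊆ P, (∀ p ∈ X, IsExchange p.1 p.2) → X.card ≤ n) :
    ∑ p ∈ P, prob (fun l : V → Fin B → Fin Q => Confused p.1 p.2 l)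
      ≤ 2 * insertionCount E * deletionProb d Q ^ B + n * exchangeProb d Q ^ B
        + E.card ^ 2 * remoteProb d Q ^ B := by
  classical
  have h0 := pow_nonneg (deletionProb_nonneg (d := d) hQ) B
  have h1 := pow_nonneg (exchangeProb_nonneg hQ hd1) B
  have h2 := pow_nonneg (remoteProb_nonneg (d := d) hQ) B
  set p0 := deletionProb d Q ^ B
  set p1 := exchangeProb d Q ^ B
  set p2 := remoteProb d Q ^ B
  have hmem : ∀ p ∈ P, p.1 ∈ E ∧ p.2 ∈ E ∧ p.1 ≠ p.2 := fun p hp => Finset.mem_offDiag.1 (hP hp)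
  -- Every pair is charged `p2`, and the near pairs are charged the bound of their own type in
  -- addition.
  have key : ∀ p ∈ P, prob (fun l : V → Fin B → Fin Q => Confused p.1 p.2 l)
      ≤ (if IsInsertion p.1 p.2 then p0 else 0) + (if IsInsertion p.2 p.1 then p0 else 0)
        + (if IsExchange p.1 p.2 then p1 else 0) + p2 := by
    intro p hp
    obtain ⟨he, he', hne⟩ := hmem p hp
    have n1 : 0 ≤ if IsInsertion p.1 p.2 then p0 else 0 := by split_ifs <;> simp [h0]
    have n2 : 0 ≤ if IsInsertion p.2 p.1 then p0 else 0 := by split_ifs <;> simp [h0]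
    have n3 : 0 ≤ if IsExchange p.1 p.2 then p1 else 0 := by split_ifs <;> simp [h1]
    have hs : prob (fun l : V → Fin B → Fin Q => Confused p.1 p.2 l)
        = prob (fun l : V → Fin B → Fin Q => Confused p.2 p.1 l) := by
      congr 1; funext l; exact propext ⟨Confused.symm, Confused.symm⟩
    rcases pair_cases hne with h | h | h | h | h
    · rw [if_pos h]
      obtain ⟨y, hy, h⟩ := h
      have := prob_confused_deletion_le (B := B) hQ hy (h ▸ hd _ he')
      rw [← h] at this
      linarith
    · rw [if_pos h, hs]
      obtain ⟨y, hy, h⟩ := h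
      have := prob_confused_deletion_le (B := B) hQ hy (h ▸ hd _ he)
      rw [← h] at this
      linarith
    · rw [if_pos h]
      obtain ⟨c, x, y, hx, hy, hxy, h, h'⟩ := h
      have := prob_confused_exchange_le (B := B) hQ hx hy hxy (h ▸ hd _ he)
      rw [← h, ← h'] at this
      linarith
    · have := prob_confused_remote_le (B := B) hQ (hd _ he') h
      linarith
    · rw [hs]
      have := prob_confused_remote_le (B := B) hQ (hd _ he) h
      linarith
  refine (Finset.sum_le_sum key).trans ?_
  rw [Finset.sum_add_distrib, Finset.sum_add_distrib, Finset.sum_add_distrib]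
  have hPE : P ⊆ E ×ˢ E := hP.trans (by
    intro p hp
    rw [Finset.mem_offDiag] at hp
    exact Finset.mem_product.2 ⟨hp.1, hp.2.1⟩)
  have s1 : ∑ p ∈ P, (if IsInsertion p.1 p.2 then p0 else 0) ≤ insertionCount E * p0 := by
    rw [← Finset.sum_filter, Finset.sum_const, nsmul_eq_mul]
    refine mul_le_mul_of_nonneg_right ?_ h0
    unfold insertionCount
    exact_mod_cast Finset.card_le_card (Finset.filter_subset_filter _ hPE)
  have s2 : ∑ p ∈ P, (if IsInsertion p.2 p.1 then p0 else 0) ≤ insertionCount E * p0 := by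
    rw [← Finset.sum_filter, Finset.sum_const, nsmul_eq_mul]
    refine mul_le_mul_of_nonneg_right ?_ h0
    unfold insertionCount
    have : (P.filter fun p => IsInsertion p.2 p.1).card
        ≤ ((E ×ˢ E).filter fun p => IsInsertion p.1 p.2).card := by
      refine Finset.card_le_card_of_injOn Prod.swap ?_ (Prod.swap_injective.injOn)
      intro p hp
      have hp' := Finset.mem_filter.1 (Finset.mem_coe.1 hp)
      have := Finset.mem_product.1 (hPE hp'.1)
      exact Finset.mem_coe.2
        (Finset.mem_filter.2 ⟨Finset.mem_product.2 ⟨this.2, this.1⟩, hp'.2⟩)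
    exact_mod_cast this
  have s3 : ∑ p ∈ P, (if IsExchange p.1 p.2 then p1 else 0) ≤ n * p1 := by
    rw [← Finset.sum_filter, Finset.sum_const, nsmul_eq_mul]
    refine mul_le_mul_of_nonneg_right ?_ h1
    exact_mod_cast hn _ (Finset.filter_subset _ _) fun p hp => (Finset.mem_filter.1 hp).2
  have s4 : ∑ _p ∈ P, p2 ≤ E.card ^ 2 * p2 := by
    rw [Finset.sum_const, nsmul_eq_mul]
    refine mul_le_mul_of_nonneg_right ?_ h2
    have := Finset.card_le_card hPE
    rw [Finset.card_product, ← sq] at this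
    exact_mod_cast this
  linarith

/-- The first moment method over all pairs of edges. -/
lemma separable_of_first_moment (hQ : 2 ≤ Q) (hd1 : 1 ≤ d) {E : Finset (Finset V)}
    (hd : ∀ e ∈ E, e.card ≤ d)
    (h : 2 * insertionCount E * deletionProb d Q ^ B + (E.card : ℝ) ^ 2 * exchangeProb d Q ^ B
        + (E.card : ℝ) ^ 2 * remoteProb d Q ^ B < 1) : Separable E (B * Q) := by
  classical
  have : NeZero Q := ⟨by omega⟩
  have hs := sum_prob_confused_le (B := B) hQ hd1 hd E.offDiag (le_refl _) (n := E.card ^ 2)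
    fun X hX _ => (Finset.card_le_card hX).trans (by
      rw [Finset.offDiag_card, sq]; exact Nat.sub_le _ _)
  push_cast at hs
  obtain ⟨l, hl⟩ := exists_forall_not_of_sum_prob_lt_one E.offDiag
    (fun p (l : V → Fin B → Fin Q) => Confused p.1 p.2 l) (hs.trans_lt h)
  exact separable_of_labelling l fun e he e' he' hne =>
    hl (e, e') (Finset.mem_offDiag.2 ⟨he, he', hne⟩)

end Pairs

/-! ### Hypergraphs of bounded rank -/

section HeavyCores

variable {V : Type*} [Fintype V] [DecidableEq V] {B Q d : ℕ}

/-- In every coordinate, addition of the label `z` or of the label `w` to the labels of `c` gives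
the same set. -/
def Matching (c : Finset V) (l : V → Fin B → Fin Q) (z w : Fin B → Fin Q) : Prop :=
  ∀ j, insert (z j) (c.image fun v => l v j) = insert (w j) (c.image fun v => l v j)

lemma confused_insert_insert_iff {c : Finset V} {x y : V} (l : V → Fin B → Fin Q) :
    Confused (insert x c) (insert y c) l ↔ Matching c l (l x) (l y) :=
  forall_congr' fun j => by rw [Finset.image_insert, Finset.image_insert]

lemma matching_congr {c : Finset V} {l l' : V → Fin B → Fin Q} (h : ∀ v ∈ c, l v = l' v)
    (z w : Fin B → Fin Q) : Matching c l z w ↔ Matching c l' z w := by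
  have : ∀ j, (c.image fun v => l v j) = c.image fun v => l' v j := fun j =>
    Finset.image_congr fun v hv => by simp [h v hv]
  simp only [Matching, this]

/-- The labels of `x` and `y` are independent of those on `c`, so a fresh pair (z, w) can stand in
for them. -/
lemma avg_prob_matching [NeZero Q] {c : Finset V} {x y : V} (hx : x ∉ c) (hy : y ∉ c)
    (hxy : x ≠ y) :
    (avg fun l : V → Fin B → Fin Q => prob fun p : (Fin B → Fin Q) × (Fin B → Fin Q) =>
        Matching c l p.1 p.2)
      = prob fun l : V → Fin B → Fin Q => Confused (insert x c) (insert y c) l := by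
  classical
  rw [prob_eq_avg fun l : V → Fin B → Fin Q => Confused (insert x c) (insert y c) l,
    avg_update y fun l : V → Fin B → Fin Q =>
      if Confused (insert x c) (insert y c) l then (1 : ℝ) else 0,
    avg_update x fun l : V → Fin B → Fin Q => avg fun w : Fin B → Fin Q =>
      if Confused (insert x c) (insert y c) (Function.update l y w) then (1 : ℝ) else 0]
  congr 1
  funext l
  rw [prob_eq_avg, avg_prod]
  congr 1
  funext z
  congr 1
  funext w
  refine if_congr ?_ rfl rfl
  rw [confused_insert_insert_iff, Function.update_self, Function.update_of_ne hxy,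
    Function.update_self]
  refine matching_congr (fun v hv => ?_) _ _
  rw [Function.update_of_ne, Function.update_of_ne]
  · rintro rfl; exact hx hv
  · rintro rfl; exact hy hv

/-- The vertices whose addition to `c` gives a member of `E`. -/
def petals (E : Finset (Finset V)) (c : Finset V) : Finset V :=
  Finset.univ.filter fun x => x ∉ c ∧ insert x c ∈ E

/-- The sets with at least `h` petals. -/
def heavyCores (E : Finset (Finset V)) (h : ℕ) : Finset (Finset V) :=
  Finset.univ.filter fun c => h ≤ (petals E c).card

lemma mem_heavyCores {E : Finset (Finset V)} {h : ℕ} {c : Finset V} :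
    c ∈ heavyCores E h ↔ h ≤ (petals E c).card := by
  simp [heavyCores]

/-- Double counting: (c, x) ↦ (c ∪ {x}, x) embeds the core-petal pairs into the edge-vertex
incidences. -/
lemma card_heavyCores_mul_le {E : Finset (Finset V)} (hd : ∀ e ∈ E, e.card ≤ d) (h : ℕ) :
    (heavyCores E h).card * h ≤ E.card * d := by
  have h1 : (heavyCores E h).card * h ≤ ((heavyCores E h).sigma (petals E)).card := by
    rw [Finset.card_sigma, ← smul_eq_mul]
    exact Finset.card_nsmul_le_sum _ _ _ fun c hc => mem_heavyCores.1 hc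
  have h2 : ((heavyCores E h).sigma (petals E)).card ≤ (E.sigma fun e => e).card := by
    refine Finset.card_le_card_of_injOn (fun p => ⟨insert p.2 p.1, p.2⟩) ?_ ?_
    · rintro ⟨c, x⟩ hp
      simp only [petals, Finset.coe_sigma, Set.mem_sigma_iff, Finset.mem_coe,
        Finset.mem_filter, Finset.mem_univ, true_and] at hp ⊢
      exact ⟨hp.2.2, Finset.mem_insert_self _ _⟩
    · rintro ⟨c, x⟩ hp ⟨c', x'⟩ hp' heq
      simp only [petals, Finset.coe_sigma, Set.mem_sigma_iff, Finset.mem_coe,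
        Finset.mem_filter, Finset.mem_univ, true_and] at hp hp'
      simp only [Sigma.mk.injEq, heq_eq_eq] at heq
      obtain ⟨h3, rfl⟩ := heq
      have : (insert x c).erase x = (insert x c').erase x := by rw [h3]
      rw [Finset.erase_insert hp.2.1, Finset.erase_insert hp'.2.1] at this
      rw [this]
  rw [Finset.card_sigma E] at h2
  have h3 := Finset.sum_le_card_nsmul E (fun e => e.card) d hd
  rw [smul_eq_mul] at h3
  omega

/-- The vertices of the heavy cores. -/
def heavyVertices (E : Finset (Finset V)) (h : ℕ) : Finset V := (heavyCores E h).biUnion id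

lemma card_heavyVertices_le {E : Finset (Finset V)} (hd : ∀ e ∈ E, e.card ≤ d) {h : ℕ}
    (hh : 1 ≤ h) : (heavyVertices E h).card ≤ (heavyCores E h).card * d := by
  refine Finset.card_biUnion_le_card_mul _ _ _ fun c hc => ?_
  obtain ⟨x, hx⟩ : (petals E c).Nonempty :=
    Finset.card_pos.1 (lt_of_lt_of_le hh (mem_heavyCores.1 hc))
  simp only [petals, Finset.mem_filter, Finset.mem_univ, true_and] at hx
  exact (Finset.card_le_card (Finset.subset_insert x c)).trans (hd _ hx.2)

/-- `e'` arises from `e` by the exchange of one vertex for another one, where the vertices are not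
in heavy cores and the remaining ones form a heavy core. -/
def IsHeavyExchange (E : Finset (Finset V)) (h : ℕ) (e e' : Finset V) : Prop :=
  ∃ c ∈ heavyCores E h, ∃ x y, x ∉ heavyVertices E h ∧ y ∉ heavyVertices E h ∧ x ≠ y ∧
    e = insert x c ∧ e' = insert y c

/-- A pair is encoded by one edge, the vertex removed and the vertex inserted. If the core is light,
the inserted vertex is one of fewer than `h` petals; otherwise `x` or `y` is a heavy vertex, and the
encoding that starts from the opposite edge inserts it. -/
lemma card_exchange_le {E : Finset (Finset V)} (hd : ∀ e ∈ E, e.card ≤ d) {h : ℕ}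
    (X : Finset (Finset V × Finset V)) (hXE : X ⊆ E.offDiag)
    (hX : ∀ p ∈ X, IsExchange p.1 p.2) (hX' : ∀ p ∈ X, ¬ IsHeavyExchange E h p.1 p.2) :
    X.card ≤ E.card * (d * (h + 2 * (heavyVertices E h).card)) := by
  classical
  set S := heavyVertices E h with hS
  let f : (Σ _ : Finset V, V × V) → Finset V × Finset V :=
    fun q => (q.1, insert q.2.2 (q.1.erase q.2.1))
  let light : Finset (Σ _ : Finset V, V × V) := E.sigma fun e =>
    e.biUnion fun x => if (petals E (e.erase x)).card < h then ({x} ×ˢ petals E (e.erase x)) else ∅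
  let left : Finset (Σ _ : Finset V, V × V) := E.sigma fun e => e ×ˢ S
  have hsub : X ⊆ light.image f ∪ (left.image f ∪ (left.image f).image Prod.swap) := by
    rintro ⟨e, e'⟩ hp
    have hE := Finset.mem_offDiag.1 (hXE hp)
    obtain ⟨c, x, y, hx, hy, hxy, rfl, rfl⟩ := hX _ hp
    simp only at hE
    have hfx : f ⟨insert x c, (x, y)⟩ = (insert x c, insert y c) := by
      simp [f, Finset.erase_insert hx]
    have hfy : f ⟨insert y c, (y, x)⟩ = (insert y c, insert x c) := by
      simp [f, Finset.erase_insert hy]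
    by_cases hlight : (petals E c).card < h
    · refine Finset.mem_union_left _ (Finset.mem_image.2 ⟨⟨insert x c, (x, y)⟩, ?_, hfx⟩)
      refine Finset.mem_sigma.2 ⟨hE.1, Finset.mem_biUnion.2 ⟨x, Finset.mem_insert_self _ _, ?_⟩⟩
      simp only [Finset.erase_insert hx, if_pos hlight]
      simp [petals, hy, hE.2.1]
    · refine Finset.mem_union_right _ ?_
      by_cases hyS : y ∈ S
      · refine Finset.mem_union_left _ (Finset.mem_image.2 ⟨⟨insert x c, (x, y)⟩, ?_, hfx⟩)
        exact Finset.mem_sigma.2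
          ⟨hE.1, Finset.mem_product.2 ⟨Finset.mem_insert_self _ _, hyS⟩⟩
      by_cases hxS : x ∈ S
      · refine Finset.mem_union_right _ (Finset.mem_image.2 ⟨_, Finset.mem_image.2
          ⟨⟨insert y c, (y, x)⟩, ?_, hfy⟩, rfl⟩)
        exact Finset.mem_sigma.2
          ⟨hE.2.1, Finset.mem_product.2 ⟨Finset.mem_insert_self _ _, hxS⟩⟩
      · exact absurd ⟨c, mem_heavyCores.2 (not_lt.1 hlight), x, y, hxS, hyS, hxy, rfl, rfl⟩
          (hX' _ hp)
  have h1 : light.card ≤ E.card * (d * h) := by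
    rw [Finset.card_sigma, ← smul_eq_mul]
    refine Finset.sum_le_card_nsmul _ _ _ fun e he => ?_
    refine (Finset.card_biUnion_le_card_mul e _ h fun x _ => ?_).trans
      (Nat.mul_le_mul_right _ (hd e he))
    split_ifs with hlt
    · rw [Finset.card_product, Finset.card_singleton, one_mul]
      exact hlt.le
    · simp
  have h2 : left.card ≤ E.card * (d * S.card) := by
    rw [Finset.card_sigma, ← smul_eq_mul]
    refine Finset.sum_le_card_nsmul _ _ _ fun e he => ?_
    rw [Finset.card_product]
    exact Nat.mul_le_mul_right _ (hd e he)
  calc X.card ≤ (light.image f ∪ (left.image f ∪ (left.image f).image Prod.swap)).card :=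
        Finset.card_le_card hsub
    _ ≤ light.card + (left.card + left.card) := by
        refine (Finset.card_union_le _ _).trans (add_le_add Finset.card_image_le ?_)
        exact (Finset.card_union_le _ _).trans
          (add_le_add Finset.card_image_le (Finset.card_image_le.trans Finset.card_image_le))
    _ ≤ E.card * (d * h) + (E.card * (d * S.card) + E.card * (d * S.card)) := by gcongr
    _ = _ := by ring

/-- The labels of the vertices in heavy cores are chosen first; the labels of the other vertices
are chosen without conflicts. -/
lemma separable_of_heavyCores (hQ : 2 ≤ Q) (hd1 : 1 ≤ d) {E : Finset (Finset V)}
    (hE : 1 ≤ E.card) (hd : ∀ e ∈ E, e.card ≤ d) {h : ℕ} (hh : 2 ≤ h)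
    (hlt : 4 ^ (2 * d) * (2 * insertionCount E * deletionProb d Q ^ B
        + ((E.card * (d * (h + 2 * (heavyVertices E h).card)) : ℕ) : ℝ) * exchangeProb d Q ^ B
        + (E.card : ℝ) ^ 2 * remoteProb d Q ^ B)
      + 8 * (E.card * d : ℕ) * ((heavyCores E h).card * exchangeProb d Q ^ B) < 1) :
    Separable E (B * Q) := by
  classical
  have : NeZero Q := ⟨by omega⟩
  set S := heavyVertices E h with hS
  set n : ℕ := E.card * d with hn
  have hnpos : 0 < n := Nat.mul_pos (by omega) (by omega)
  set P := E.offDiag.filter fun p => ¬ IsHeavyExchange E h p.1 p.2 with hP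
  let R : (V → Fin B → Fin Q) → (Fin B → Fin Q) → (Fin B → Fin Q) → Prop :=
    fun l z w => ∃ c ∈ heavyCores E h, Matching c l z w
  -- One functional carries both requirements on the labels of `S`: few expected confusions among
  -- the pairs in `P`, and rare conflicts. A single averaging step then secures both.
  let F : (V → Fin B → Fin Q) → ℝ := fun l₀ =>
    4 ^ (2 * d) * ∑ p ∈ P, prob (fun l => Confused p.1 p.2 (S.piecewise l₀ l))
      + 8 * n * prob fun p : (Fin B → Fin Q) × (Fin B → Fin Q) => R l₀ p.1 p.2
  have hF : avg F < 1 := by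
    refine lt_of_le_of_lt ?_ hlt
    have e1 : avg F = 4 ^ (2 * d) * ∑ p ∈ P,
          (avg fun l₀ => prob fun l : V → Fin B → Fin Q =>
            Confused p.1 p.2 (S.piecewise l₀ l))
        + 8 * n * avg fun l₀ => prob fun p : (Fin B → Fin Q) × (Fin B → Fin Q) =>
            R l₀ p.1 p.2 := by
      rw [avg_add, avg_mul_left, avg_mul_left, avg_sum]
    have e2 : ∀ p : Finset V × Finset V, (avg fun l₀ => prob fun l : V → Fin B → Fin Q =>
        Confused p.1 p.2 (S.piecewise l₀ l))
          = prob fun l : V → Fin B → Fin Q => Confused p.1 p.2 l := by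
      intro p
      simp only [prob_eq_avg]
      exact (avg_piecewise S fun l : V → Fin B → Fin Q =>
        if Confused p.1 p.2 l then (1 : ℝ) else 0).symm
    rw [e1]
    simp only [e2]
    refine add_le_add (mul_le_mul_of_nonneg_left ?_ (by positivity))
      (mul_le_mul_of_nonneg_left ?_ (by positivity))
    · refine sum_prob_confused_le hQ hd1 hd P (Finset.filter_subset _ _) fun X hX hX' => ?_
      exact card_exchange_le hd X (hX.trans (Finset.filter_subset _ _)) hX'
        fun p hp => (Finset.mem_filter.1 (hX hp)).2
    · calc (avg fun l₀ => prob fun p : (Fin B → Fin Q) × (Fin B → Fin Q) => R l₀ p.1 p.2)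
          ≤ avg fun l₀ => ∑ c ∈ heavyCores E h,
              prob fun p : (Fin B → Fin Q) × (Fin B → Fin Q) => Matching c l₀ p.1 p.2 :=
            avg_mono fun l₀ => prob_exists_le _ _
        _ = ∑ c ∈ heavyCores E h, avg fun l₀ =>
              prob fun p : (Fin B → Fin Q) × (Fin B → Fin Q) => Matching c l₀ p.1 p.2 :=
            avg_sum _ _
        _ ≤ ∑ c ∈ heavyCores E h, exchangeProb d Q ^ B := by
            refine Finset.sum_le_sum fun c hc => ?_
            -- A heavy core has two petals, so matching on it is an exchange of edges in `E`.
            obtain ⟨x, hx, y, hy, hxy⟩ := Finset.one_lt_card.1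
              (lt_of_lt_of_le (by omega : 1 < h) (mem_heavyCores.1 hc))
            simp only [petals, Finset.mem_filter, Finset.mem_univ, true_and] at hx hy
            rw [avg_prob_matching hx.1 hy.1 hxy]
            exact prob_confused_exchange_le hQ hx.1 hy.1 hxy (hd _ hx.2)
        _ = (heavyCores E h).card * exchangeProb d Q ^ B := by
            rw [Finset.sum_const, nsmul_eq_mul]
  obtain ⟨l₀, hl₀⟩ := exists_le_avg F
  have hF0 : F l₀ < 1 := hl₀.trans_lt hF
  have hsum0 : 0 ≤ 4 ^ (2 * d) * ∑ p ∈ P,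
      prob (fun l : V → Fin B → Fin Q => Confused p.1 p.2 (S.piecewise l₀ l)) :=
    mul_nonneg (by positivity) (Finset.sum_nonneg fun p _ => prob_nonneg _)
  have hR0 : 0 ≤ 8 * n * prob fun p : (Fin B → Fin Q) × (Fin B → Fin Q) => R l₀ p.1 p.2 :=
    mul_nonneg (by positivity) (prob_nonneg _)
  have hA : ((E.biUnion id) \ S).card ≤ n :=
    (Finset.card_le_card Finset.sdiff_subset).trans
      (Finset.card_biUnion_le_card_mul _ _ _ fun e he => hd e he)
  obtain ⟨l, hl, hl'⟩ := exists_conflictFree (V := V) (Ω := Fin B → Fin Q) (R := R l₀)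
    (fun z w ⟨c, hc, hm⟩ => ⟨c, hc, fun j => (hm j).symm⟩) hnpos
    (by simp only [F] at hF0; linarith) hA P (fun p => p.1 ∪ p.2) (k := 2 * d)
    (fun p hp => by
      have := Finset.mem_offDiag.1 (Finset.mem_filter.1 hp).1
      have h1 := hd _ this.1
      have h2 := hd _ this.2.1
      have h3 := Finset.card_union_le p.1 p.2
      omega)
    (fun p l => Confused p.1 p.2 (S.piecewise l₀ l))
    (fun p _ g g' hg => by
      refine forall_congr' fun j => ?_
      have : ∀ v ∈ p.1 ∪ p.2, S.piecewise l₀ g v j = S.piecewise l₀ g' v j := by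
        intro v hv
        by_cases hvS : v ∈ S
        · simp [hvS]
        · simp [hvS, hg v hv]
      rw [Finset.image_congr fun v hv => this v (Finset.mem_union_left _ hv),
        Finset.image_congr fun v hv => this v (Finset.mem_union_right _ hv)])
    (by
      rw [← Finset.mul_sum]
      simp only [F] at hF0
      linarith)
  refine separable_of_labelling (S.piecewise l₀ l) fun e he e' he' hne hcon => ?_
  -- In a heavy exchange the core lies in `S`, where `l₀` decides, and both exchanged vertices lie
  -- outside; confusion would be a conflict.
  by_cases hhe : IsHeavyExchange E h e e'
  · obtain ⟨c, hc, x, y, hx, hy, hxy, rfl, rfl⟩ := hhe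
    rw [confused_insert_insert_iff, Finset.piecewise_eq_of_notMem _ _ _ hx,
      Finset.piecewise_eq_of_notMem _ _ _ hy] at hcon
    refine hl x ?_ y ?_ hxy ⟨c, hc, (matching_congr (fun v hv => ?_) _ _).1 hcon⟩
    · exact Finset.mem_sdiff.2 ⟨Finset.mem_biUnion.2 ⟨_, he, Finset.mem_insert_self _ _⟩, hx⟩
    · exact Finset.mem_sdiff.2 ⟨Finset.mem_biUnion.2 ⟨_, he', Finset.mem_insert_self _ _⟩, hy⟩
    · exact Finset.piecewise_eq_of_mem _ _ _ (Finset.mem_biUnion.2 ⟨c, hc, hv⟩)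
  · exact hl' (e, e') (Finset.mem_filter.2 ⟨Finset.mem_offDiag.2 ⟨he, he', hne⟩, hhe⟩) hcon

end HeavyCores

/-! ### The edge isoperimetric inequality in the cube -/

/-- Combine log₂(a + b) ≥ log₂(2a), weighted by a, with 2^(a/b) ≤ 1 + a/b (Bernoulli), weighted by
b. -/
lemma mul_logb_add_mul_logb_add_le {a b : ℝ} (ha : 0 < a) (hab : a ≤ b) :
    a * Real.logb 2 a + b * Real.logb 2 b + 2 * a ≤ (a + b) * Real.logb 2 (a + b) := by
  have hb : 0 < b := ha.trans_le hab
  have h1 : Real.logb 2 a + 1 ≤ Real.logb 2 (a + b) := by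
    have : Real.logb 2 (2 * a) ≤ Real.logb 2 (a + b) :=
      Real.logb_le_logb_of_le (by norm_num) (by linarith) (by linarith)
    rw [Real.logb_mul (by norm_num) ha.ne', Real.logb_self_eq_one (by norm_num)] at this
    linarith
  have h2 : a / b ≤ Real.logb 2 (a + b) - Real.logb 2 b := by
    rw [← Real.logb_div (by positivity) hb.ne', Real.le_logb_iff_rpow_le (by norm_num)
      (by positivity)]
    have := rpow_one_add_le_one_add_mul_self (s := (1 : ℝ)) (by norm_num)
      (show 0 ≤ a / b by positivity) ((div_le_one hb).2 hab)
    rw [show (1 : ℝ) + 1 = 2 by norm_num] at this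
    refine this.trans (le_of_eq ?_)
    field_simp
    ring
  have h3 := mul_le_mul_of_nonneg_left h1 ha.le
  have h4 := mul_le_mul_of_nonneg_left h2 hb.le
  rw [mul_div_cancel₀ _ hb.ne'] at h4
  linarith

section Isoperimetry

variable {V : Type*} [DecidableEq V]

/-- Pairs that cross the split have the form (e, e ∪ {x}), hence form a matching between the halves.
-/
lemma insertionCount_le_add (E : Finset (Finset V)) (x : V) :
    insertionCount E ≤ insertionCount (E.filter fun e => x ∉ e)
      + insertionCount (E.filter fun e => x ∈ e)
      + min (E.filter fun e => x ∉ e).card (E.filter fun e => x ∈ e).card := by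
  classical
  set A := E.filter fun e => x ∉ e with hA
  set A' := E.filter fun e => x ∈ e with hA'
  set C := (A ×ˢ A').filter fun p => IsInsertion p.1 p.2 with hC
  have hCx : ∀ p ∈ C, p.2 = insert x p.1 := by
    rintro ⟨e, e'⟩ hp
    simp only [hC, hA, hA', Finset.mem_filter, Finset.mem_product] at hp
    obtain ⟨⟨⟨-, hx⟩, -, hx'⟩, y, -, rfl⟩ := hp
    rw [Finset.mem_insert] at hx'
    rcases hx' with rfl | hx'
    · rfl
    · exact absurd hx' hx
  have hCx' : ∀ p ∈ C, x ∉ p.1 := by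
    rintro ⟨e, e'⟩ hp
    simp only [hC, hA, Finset.mem_filter, Finset.mem_product] at hp
    exact hp.1.1.2
  have h1 : C.card ≤ A.card := by
    refine Finset.card_le_card_of_injOn Prod.fst (fun p hp => ?_) fun p hp q hq h => ?_
    · exact (Finset.mem_product.1 (Finset.mem_filter.1 hp).1).1
    · refine Prod.ext h ?_
      rw [hCx p hp, hCx q hq, h]
  have h2 : C.card ≤ A'.card := by
    refine Finset.card_le_card_of_injOn Prod.snd (fun p hp => ?_) fun p hp q hq h => ?_
    · exact (Finset.mem_product.1 (Finset.mem_filter.1 hp).1).2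
    · refine Prod.ext ?_ h
      rw [← Finset.erase_insert (hCx' p hp), ← hCx p hp, h, hCx q hq,
        Finset.erase_insert (hCx' q hq)]
  have hsub : ((E ×ˢ E).filter fun p => IsInsertion p.1 p.2)
      ⊆ (((A ×ˢ A).filter fun p => IsInsertion p.1 p.2)
        ∪ ((A' ×ˢ A').filter fun p => IsInsertion p.1 p.2)) ∪ C := by
    rintro ⟨e, e'⟩ hp
    simp only [Finset.mem_filter, Finset.mem_product] at hp
    obtain ⟨⟨he, he'⟩, hins⟩ := hp
    have hmono : x ∈ e → x ∈ e' := by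
      obtain ⟨y, -, rfl⟩ := hins
      exact Finset.mem_insert_of_mem
    simp only [hC, hA, hA', Finset.mem_union, Finset.mem_filter, Finset.mem_product]
    tauto
  have h3 := (Finset.card_le_card hsub).trans
    ((Finset.card_union_le _ _).trans (Nat.add_le_add_right (Finset.card_union_le _ _) _))
  unfold insertionCount
  refine le_trans (le_of_eq ?_) (h3.trans (le_trans (Nat.add_le_add_left (le_min h1 h2) _)
    (le_of_eq ?_)))
  · congr
  · congr

/-- Induction on |E|: split along a vertex that leaves both halves nonempty and apply the entropy
inequality above. -/
lemma two_mul_insertionCount_le (E : Finset (Finset V)) :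
    2 * (insertionCount E : ℝ) ≤ E.card * Real.logb 2 E.card := by
  classical
  induction hm : E.card using Nat.strong_induction_on generalizing E with
  | _ m ih =>
  subst hm
  rcases Nat.lt_or_ge 1 E.card with hE | hE
  swap
  · have h0 : insertionCount E = 0 := by
      unfold insertionCount
      rw [Finset.card_eq_zero, Finset.filter_eq_empty_iff]
      rintro ⟨e, e'⟩ hp ⟨y, hy, h⟩
      rw [Finset.mem_product] at hp
      have := Finset.card_le_one.1 hE e hp.1 e' hp.2
      simp only at h
      exact hy (by rw [this, h]; exact Finset.mem_insert_self _ _)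
    rw [h0]
    simp only [Nat.cast_zero, mul_zero]
    refine mul_nonneg (Nat.cast_nonneg _) ?_
    rcases Nat.eq_zero_or_pos E.card with h | h
    · simp [h]
    · exact Real.logb_nonneg (by norm_num) (by exact_mod_cast h)
  obtain ⟨x, hx0, hx1⟩ : ∃ x, (E.filter fun e => x ∉ e).Nonempty
      ∧ (E.filter fun e => x ∈ e).Nonempty := by
    obtain ⟨e, he, e', he', hne⟩ := Finset.one_lt_card.1 hE
    by_contra! hcon
    refine hne (Finset.ext fun x => ?_)
    have h := hcon x
    by_cases hxe : x ∈ e <;> by_cases hxe' : x ∈ e'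
    · simp [hxe, hxe']
    · have h1 := h ⟨e', by simp [he', hxe']⟩
      rw [Finset.filter_eq_empty_iff] at h1
      exact absurd hxe (h1 he)
    · have h1 := h ⟨e, by simp [he, hxe]⟩
      rw [Finset.filter_eq_empty_iff] at h1
      exact absurd hxe' (h1 he')
    · simp [hxe, hxe']
  have hadd := Finset.card_filter_add_card_filter_not (s := E) fun e => x ∈ e
  have hle := insertionCount_le_add E x
  set A := E.filter fun e => x ∉ e
  set A' := E.filter fun e => x ∈ e
  have hA := Finset.card_pos.2 hx0
  have hA' := Finset.card_pos.2 hx1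
  have ihA := ih A.card (by omega) A rfl
  have ihA' := ih A'.card (by omega) A' rfl
  have hle' : (insertionCount E : ℝ) ≤ insertionCount A + insertionCount A'
      + (min A.card A'.card : ℕ) := by exact_mod_cast hle
  have hsum : (E.card : ℝ) = A'.card + A.card := by exact_mod_cast hadd.symm
  have hA0 : (0 : ℝ) < A.card := by exact_mod_cast hA
  have hA0' : (0 : ℝ) < A'.card := by exact_mod_cast hA'
  rcases le_total A.card A'.card with h | h
  · rw [min_eq_left h] at hle'
    have := mul_logb_add_mul_logb_add_le hA0 (by exact_mod_cast h : (A.card : ℝ) ≤ A'.card)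
    rw [hsum, add_comm (A'.card : ℝ)]
    linarith
  · rw [min_eq_right h] at hle'
    have := mul_logb_add_mul_logb_add_le hA0' (by exact_mod_cast h : (A'.card : ℝ) ≤ A.card)
    rw [hsum]
    linarith

end Isoperimetry

/-! ### The number of labels -/

section Numerics

/-- The number of labels that is used for edges of size at most `d`. -/
noncomputable def alphabetSize (d : ℕ) : ℕ := ⌈(d : ℝ) / Real.log 2⌉₊

/-- The ratio of `alphabetSize d` and `d / log 2`. -/
noncomputable def sizeRatio (d : ℕ) : ℝ := alphabetSize d * Real.log 2 / d

variable {d : ℕ}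

lemma le_alphabetSize_mul : (d : ℝ) ≤ alphabetSize d * Real.log 2 := by
  have h := Nat.le_ceil ((d : ℝ) / Real.log 2)
  rwa [div_le_iff₀ (Real.log_pos (by norm_num))] at h

lemma alphabetSize_mul_le : alphabetSize d * Real.log 2 ≤ d + Real.log 2 := by
  have hl : 0 < Real.log 2 := Real.log_pos (by norm_num)
  have h := (Nat.ceil_lt_add_one (show 0 ≤ (d : ℝ) / Real.log 2 by positivity)).le
  have h' := mul_le_mul_of_nonneg_right h hl.le
  rw [add_mul, div_mul_cancel₀ _ hl.ne', one_mul] at h'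
  exact h'

lemma lt_alphabetSize (hd : 1 ≤ d) : d < alphabetSize d := by
  have h := le_alphabetSize_mul (d := d)
  have hl := Real.log_two_lt_d9
  have hd' : (1 : ℝ) ≤ d := by exact_mod_cast hd
  by_contra! hcon
  have hcon' : (alphabetSize d : ℝ) ≤ d := by exact_mod_cast hcon
  have := mul_le_mul_of_nonneg_right hcon' (Real.log_pos one_lt_two).le
  nlinarith

lemma two_le_alphabetSize (hd : 1 ≤ d) : 2 ≤ alphabetSize d := by
  have := lt_alphabetSize hd
  omega

lemma one_le_sizeRatio (hd : 1 ≤ d) : 1 ≤ sizeRatio d := by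
  have hd' : (0 : ℝ) < d := by exact_mod_cast hd
  rw [sizeRatio, one_le_div hd']
  exact le_alphabetSize_mul

lemma sizeRatio_le (hd : 1 ≤ d) : sizeRatio d ≤ 1 + Real.log 2 / d := by
  have hd' : (0 : ℝ) < d := by exact_mod_cast hd
  rw [sizeRatio, div_le_iff₀ hd', add_mul, div_mul_cancel₀ _ hd'.ne', one_mul]
  exact alphabetSize_mul_le

lemma sizeRatio_le_two (hd : 1 ≤ d) : sizeRatio d ≤ 2 := by
  have hd' : (1 : ℝ) ≤ d := by exact_mod_cast hd
  have h1 : Real.log 2 / d ≤ 1 := by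
    rw [div_le_one (by linarith)]
    linarith [Real.log_two_lt_d9]
  linarith [sizeRatio_le hd]

/-- With r = (1 - 1/Q)^(d-1), one has 1 - r ≤ 1/(4r). So 4r ≥ 2^θ suffices, where θ = `sizeRatio d`;
this follows from log(1 - 1/Q) ≥ -1/(Q - 1). The exponent θ compensates for rounding Q up. -/
lemma deletionProb_le (hd : 1 ≤ d) : deletionProb d (alphabetSize d) ≤ 2 ^ (-sizeRatio d) := by
  have hl : 0 < Real.log 2 := Real.log_pos (by norm_num)
  have hd' : (1 : ℝ) ≤ d := by exact_mod_cast hd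
  have hQ : (2 : ℝ) ≤ alphabetSize d := by exact_mod_cast two_le_alphabetSize hd
  have h1 := le_alphabetSize_mul (d := d)
  have h2 := alphabetSize_mul_le (d := d)
  rw [deletionProb, sizeRatio]
  set Q : ℝ := (alphabetSize d : ℝ)
  have ha : 0 < 1 - 1 / Q := by
    have : 1 / Q ≤ 1 / 2 := one_div_le_one_div_of_le (by norm_num) hQ
    linarith
  set r := (1 - 1 / Q) ^ (d - 1) with hr
  have hr0 : 0 < r := pow_pos ha _
  have h3 : 1 - r ≤ 1 / (4 * r) := by
    rw [le_div_iff₀ (by positivity)]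
    nlinarith [sq_nonneg (2 * r - 1)]
  refine h3.trans ?_
  rw [Real.rpow_neg (by norm_num), ← one_div]
  refine one_div_le_one_div_of_le (by positivity) ?_
  rw [← Real.log_le_log_iff (by positivity) (by positivity), Real.log_rpow (by norm_num),
    Real.log_mul (by norm_num) hr0.ne', hr, Real.log_pow, Nat.cast_sub hd, Nat.cast_one,
    show (4 : ℝ) = 2 ^ 2 by norm_num, Real.log_pow]
  have h4 : -(1 / (Q - 1)) ≤ Real.log (1 - 1 / Q) := by
    refine le_trans (le_of_eq ?_) (Real.one_sub_inv_le_log_of_pos ha)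
    have : Q - 1 ≠ 0 := by linarith
    have hQ0 : Q ≠ 0 := by linarith
    rw [show 1 - 1 / Q = (Q - 1) / Q by field_simp, inv_div]
    field_simp
    ring
  have h5 := mul_le_mul_of_nonneg_left h4 (show (0 : ℝ) ≤ d - 1 by linarith)
  set t := Q * Real.log 2 with ht
  have h6 : (d - 1) * (1 / (Q - 1)) ≤ Real.log 2 * (2 - t / d) := by
    have e1 : (d - 1) * (1 / (Q - 1)) = Real.log 2 * (((d : ℝ) - 1) / (t - Real.log 2)) := by
      rw [ht]
      have : Q - 1 ≠ 0 := by linarith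
      have h7 : Q * Real.log 2 - Real.log 2 = (Q - 1) * Real.log 2 := by ring
      rw [h7]
      field_simp
    rw [e1]
    refine mul_le_mul_of_nonneg_left ?_ hl.le
    have h8 : 0 < t - Real.log 2 := by nlinarith
    rw [div_le_iff₀ h8, show (2 - t / d) * (t - Real.log 2)
      = ((2 * d - t) * (t - Real.log 2)) / d by field_simp, le_div_iff₀ (by linarith)]
    -- The product (2d - t)(t - log 2) is concave in t and equals d(d - log 2) ≥ d(d - 1) at both
    -- ends of the range d ≤ t ≤ d + log 2.
    nlinarith [Real.log_two_lt_d9]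
  push_cast
  nlinarith

lemma two_rpow_neg_sizeRatio_le (hd : 1 ≤ d) : (2 : ℝ) ^ (-sizeRatio d) ≤ 1 / 2 := by
  rw [one_div, ← Real.rpow_neg_one]
  exact Real.rpow_le_rpow_of_exponent_le (by norm_num) (by linarith [one_le_sizeRatio hd])

lemma one_sub_two_div_pow_le {Q : ℕ} (hQ : 2 ≤ Q) (s : ℕ) :
    (1 - 2 / (Q : ℝ)) ^ s ≤ ((1 - 1 / (Q : ℝ)) ^ s) ^ 2 := by
  have hQ' : (2 : ℝ) ≤ Q := by exact_mod_cast hQ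
  rw [← pow_mul, mul_comm, pow_mul]
  refine pow_le_pow_left₀ ?_ ?_ s
  · rw [sub_nonneg, div_le_one (by linarith)]
    exact hQ'
  · rw [show (2 : ℝ) / Q = 2 * (1 / Q) by ring]
    nlinarith [sq_nonneg (1 / (Q : ℝ))]

/-- Replace 1 - 2/Q by (1 - 1/Q)². With r = (1 - 1/Q)^(d-1), the result is exactly (1 - r)² + (2r -
r²)/Q. -/
lemma exchangeProb_le_add {Q : ℕ} (hQ : 2 ≤ Q) (hd : 1 ≤ d) :
    exchangeProb d Q ≤ deletionProb d Q ^ 2 + (1 - deletionProb d Q ^ 2) / Q := by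
  have hQ' : (2 : ℝ) ≤ Q := by exact_mod_cast hQ
  have h := one_sub_two_div_pow_le hQ (d - 1)
  have ha : 0 ≤ 1 - 1 / (Q : ℝ) := by
    rw [sub_nonneg, div_le_one (by linarith)]
    linarith
  have h' := mul_le_mul_of_nonneg_left h ha
  have hp : (1 - 1 / (Q : ℝ)) ^ d = (1 - 1 / (Q : ℝ)) ^ (d - 1) * (1 - 1 / (Q : ℝ)) := by
    rw [← pow_succ, Nat.sub_add_cancel hd]
  rw [exchangeProb, deletionProb, hp]
  generalize (1 - 1 / (Q : ℝ)) ^ (d - 1) = r at *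
  rw [div_eq_mul_one_div (1 - (1 - r) ^ 2)]
  generalize 1 / (Q : ℝ) = x at *
  nlinarith

lemma exchangeProb_le_rpow_add (hd : 1 ≤ d) :
    exchangeProb d (alphabetSize d) ≤ 2 ^ (-(2 * sizeRatio d)) + 1 / alphabetSize d := by
  have hQ := two_le_alphabetSize hd
  have h1 := exchangeProb_le_add hQ hd
  have h2 := pow_le_pow_left₀ (deletionProb_nonneg (d := d) hQ) (deletionProb_le hd) 2
  rw [← Real.rpow_natCast (_ ^ (_ : ℝ)), ← Real.rpow_mul (by norm_num)] at h2
  have h3 : (1 - deletionProb d (alphabetSize d) ^ 2) / (alphabetSize d : ℝ)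
      ≤ 1 / alphabetSize d := by
    gcongr
    linarith [sq_nonneg (deletionProb d (alphabetSize d))]
  rw [show -(2 * sizeRatio d) = -sizeRatio d * (2 : ℕ) by push_cast; ring]
  exact h1.trans (add_le_add h2 h3)

/-- Rounding the exponent up to a rational p/q turns the comparison into exact arithmetic for small
d. -/
lemma le_two_rpow_neg {x y : ℝ} {p q : ℕ} (hx : 0 ≤ x) (hq : 0 < q) (hy : y ≤ p / q)
    (h : x ^ q * 2 ^ p ≤ 1) : x ≤ 2 ^ (-y) := by
  have hq' : (0 : ℝ) < q := by exact_mod_cast hq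
  have h1 : (2 : ℝ) ^ (-((p : ℝ) / q)) ≤ 2 ^ (-y) :=
    Real.rpow_le_rpow_of_exponent_le (by norm_num) (by linarith)
  refine le_trans ?_ h1
  rw [← pow_le_pow_iff_left₀ hx (by positivity) hq.ne', ← Real.rpow_natCast (_ ^ _),
    ← Real.rpow_mul (by norm_num), neg_mul, div_mul_cancel₀ _ hq'.ne', Real.rpow_neg (by norm_num),
    Real.rpow_natCast, ← one_div, le_div_iff₀ (by positivity)]
  exact h

lemma alphabetSize_eq {n : ℕ} (h1 : ((n : ℝ) - 1) * 0.6931471808 < d)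
    (h2 : (d : ℝ) ≤ n * 0.6931471803) (hn : 1 ≤ n) : alphabetSize d = n := by
  have hl := Real.log_two_lt_d9
  have hl' := Real.log_two_gt_d9
  have hn' : (1 : ℝ) ≤ n := by exact_mod_cast hn
  rw [alphabetSize, Nat.ceil_eq_iff (by omega), Nat.cast_sub hn, Nat.cast_one]
  constructor
  · rw [lt_div_iff₀ (by linarith)]
    nlinarith
  · rw [div_le_iff₀ (by linarith)]
    nlinarith

lemma alphabetSize_two : alphabetSize 2 = 3 :=
  alphabetSize_eq (by norm_num) (by norm_num) (by norm_num)

lemma alphabetSize_three : alphabetSize 3 = 5 :=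
  alphabetSize_eq (by norm_num) (by norm_num) (by norm_num)

lemma alphabetSize_four : alphabetSize 4 = 6 :=
  alphabetSize_eq (by norm_num) (by norm_num) (by norm_num)

lemma alphabetSize_five : alphabetSize 5 = 8 :=
  alphabetSize_eq (by norm_num) (by norm_num) (by norm_num)

lemma nine_le_alphabetSize (hd : 6 ≤ d) : (9 : ℝ) ≤ alphabetSize d := by
  have h := le_alphabetSize_mul (d := d)
  have hd' : (6 : ℝ) ≤ d := by exact_mod_cast hd
  have hl := Real.log_two_lt_d9
  have : 8 < alphabetSize d := by
    by_contra! hcon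
    have hcon' : (alphabetSize d : ℝ) ≤ 8 := by exact_mod_cast hcon
    have := mul_le_mul_of_nonneg_right hcon' (Real.log_pos one_lt_two).le
    linarith
  exact_mod_cast this

/-- The exponent 3/2 matches the count m^(3/2) of exchange pairs. It fails for d = 1, where Q = 2
and two vertices share a letter with probability 1/2. -/
lemma exchangeProb_le (hd : 2 ≤ d) :
    exchangeProb d (alphabetSize d) ≤ 2 ^ (-(3 / 2 * sizeRatio d)) := by
  have hl := Real.log_two_lt_d9
  have hnn := exchangeProb_nonneg (two_le_alphabetSize (show 1 ≤ d by omega)) (show 1 ≤ d by omega)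
  rcases Nat.lt_or_ge d 6 with h6 | h6
  · interval_cases d
    · refine le_two_rpow_neg (p := 39) (q := 25) hnn (by norm_num) ?_ ?_
      · rw [sizeRatio, alphabetSize_two]; push_cast; linarith
      · rw [exchangeProb, alphabetSize_two]; norm_num
    · refine le_two_rpow_neg (p := 7) (q := 4) hnn (by norm_num) ?_ ?_
      · rw [sizeRatio, alphabetSize_three]; push_cast; linarith
      · rw [exchangeProb, alphabetSize_three]; norm_num
    · refine le_two_rpow_neg (p := 8) (q := 5) hnn (by norm_num) ?_ ?_
      · rw [sizeRatio, alphabetSize_four]; push_cast; linarith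
      · rw [exchangeProb, alphabetSize_four]; norm_num
    · refine le_two_rpow_neg (p := 5) (q := 3) hnn (by norm_num) ?_ ?_
      · rw [sizeRatio, alphabetSize_five]; push_cast; linarith
      · rw [exchangeProb, alphabetSize_five]; norm_num
  · have hd1 : 1 ≤ d := by omega
    have hd' : (6 : ℝ) ≤ d := by exact_mod_cast h6
    have hQ := two_le_alphabetSize hd1
    have hQ9 := nine_le_alphabetSize h6
    have h1 := exchangeProb_le_add hQ hd1
    have h0 := deletionProb_nonneg (d := d) hQ
    have h2 := deletionProb_le hd1
    have hθ : sizeRatio d ≤ 9 / 8 := by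
      have := sizeRatio_le hd1
      have h3 : Real.log 2 / d ≤ 1 / 8 := by
        rw [div_le_iff₀ (by linarith)]
        linarith
      linarith
    have hθ1 := one_le_sizeRatio hd1
    -- The claim becomes (8/9)v⁴ + 1/9 ≤ v³, which holds on the range of v given by 1 ≤ θ ≤ 9/8.
    set v : ℝ := 2 ^ (-(sizeRatio d / 2)) with hv
    have hv0 : 0 < v := Real.rpow_pos_of_pos (by norm_num) _
    have hv1 : v ≤ 0.7072 := by
      have h3 : v ≤ 2 ^ (-(1 / 2) : ℝ) :=
        Real.rpow_le_rpow_of_exponent_le (by norm_num) (by linarith)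
      have h4 : v ^ 2 ≤ 1 / 2 := by
        refine (pow_le_pow_left₀ hv0.le h3 2).trans (le_of_eq ?_)
        rw [← Real.rpow_natCast, ← Real.rpow_mul (by norm_num)]
        norm_num
      nlinarith
    have hv2 : 0.675 ≤ v :=
      le_two_rpow_neg (p := 9) (q := 16) (by norm_num) (by norm_num)
        (by push_cast; linarith) (by norm_num)
    have e2 : (2 : ℝ) ^ (-sizeRatio d) = v ^ 2 := by
      rw [hv, ← Real.rpow_natCast, ← Real.rpow_mul (by norm_num)]
      congr 1
      push_cast
      ring
    have e3 : (2 : ℝ) ^ (-(3 / 2 * sizeRatio d)) = v ^ 3 := by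
      rw [hv, ← Real.rpow_natCast, ← Real.rpow_mul (by norm_num)]
      congr 1
      push_cast
      ring
    rw [e2] at h2
    rw [e3]
    set f := deletionProb d (alphabetSize d)
    have hf : f ^ 2 ≤ v ^ 4 := by
      have := pow_le_pow_left₀ h0 h2 2
      rwa [← pow_mul] at this
    have hv4 : v ^ 4 ≤ 1 := pow_le_one₀ hv0.le (by linarith)
    have h5 : (1 - f ^ 2) / (alphabetSize d : ℝ) ≤ (1 - f ^ 2) / 9 :=
      div_le_div_of_nonneg_left (by linarith) (by norm_num) hQ9
    have h6 : 0.3075 ≤ v ^ 3 := by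
      have := pow_le_pow_left₀ (by norm_num) hv2 3
      norm_num at this ⊢
      linarith
    have h7 : v ^ 4 = v ^ 3 * v := by ring
    nlinarith

lemma remoteProb_le (hd : 2 ≤ d) :
    remoteProb d (alphabetSize d) ≤ 2 ^ (-(2 * sizeRatio d)) := by
  have hl := Real.log_two_lt_d9
  have hd1 : 1 ≤ d := by omega
  have hQ := two_le_alphabetSize hd1
  have hnn := remoteProb_nonneg (d := d) hQ
  rcases Nat.lt_or_ge d 6 with h6 | h6
  · interval_cases d
    · refine le_two_rpow_neg (p := 21) (q := 10) hnn (by norm_num) ?_ ?_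
      · rw [sizeRatio, alphabetSize_two]; push_cast; linarith
      · rw [remoteProb, alphabetSize_two]; norm_num
    · refine le_two_rpow_neg (p := 5) (q := 2) hnn (by norm_num) ?_ ?_
      · rw [sizeRatio, alphabetSize_three]; push_cast; linarith
      · rw [remoteProb, alphabetSize_three]; norm_num
    · refine le_two_rpow_neg (p := 5) (q := 2) hnn (by norm_num) ?_ ?_
      · rw [sizeRatio, alphabetSize_four]; push_cast; linarith
      · rw [remoteProb, alphabetSize_four]; norm_num
    · refine le_two_rpow_neg (p := 5) (q := 2) hnn (by norm_num) ?_ ?_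
      · rw [sizeRatio, alphabetSize_five]; push_cast; linarith
      · rw [remoteProb, alphabetSize_five]; norm_num
  · have hd' : (6 : ℝ) ≤ d := by exact_mod_cast h6
    have hQ9 := nine_le_alphabetSize h6
    have h0 := deletionProb_nonneg (d := d) hQ
    have h2 := deletionProb_le hd1
    have h3 := two_rpow_neg_sizeRatio_le hd1
    have hsq := pow_le_pow_left₀ h0 h2 2
    rw [← Real.rpow_natCast (_ ^ (_ : ℝ)), ← Real.rpow_mul (by norm_num)] at hsq
    rw [show -(2 * sizeRatio d) = -sizeRatio d * (2 : ℕ) by push_cast; ring]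
    refine le_trans ?_ hsq
    have hf2 := h2.trans h3
    have hb := one_sub_two_div_pow_le hQ (d - 2)
    have hup := alphabetSize_mul_le (d := d)
    have hf1 : 0.28 ≤ deletionProb d (alphabetSize d) := by
      have h4 : (1 - 1 / (alphabetSize d : ℝ)) ^ (d - 1) ≤ 1 / 1.45 := by
        have h5 : 1 - 1 / (alphabetSize d : ℝ) ≤ Real.exp (-(1 / alphabetSize d)) := by
          linarith [Real.add_one_le_exp (-(1 / (alphabetSize d : ℝ)))]
        have h6 : 0 ≤ 1 - 1 / (alphabetSize d : ℝ) := by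
          rw [sub_nonneg, div_le_one (by linarith)]
          linarith
        refine (pow_le_pow_left₀ h6 h5 _).trans ?_
        rw [← Real.exp_nat_mul, Nat.cast_sub hd1, Nat.cast_one, mul_neg, Real.exp_neg, ← one_div]
        refine one_div_le_one_div_of_le (by norm_num) ?_
        have h7 : 0.45 ≤ ((d : ℝ) - 1) * (1 / alphabetSize d) := by
          rw [mul_one_div, le_div_iff₀ (by linarith)]
          nlinarith [Real.log_two_gt_d9]
        linarith [Real.add_one_le_exp (((d : ℝ) - 1) * (1 / alphabetSize d))]
      rw [deletionProb]
      norm_num at h4 ⊢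
      linarith
    have hp : (1 - 1 / (alphabetSize d : ℝ)) ^ (d - 1)
        = (1 - 1 / (alphabetSize d : ℝ)) ^ (d - 2) * (1 - 1 / (alphabetSize d : ℝ)) := by
      rw [← pow_succ]
      congr 1
      omega
    rw [deletionProb, hp] at hf1 hf2 ⊢
    clear hsq h2 h0 hp
    rw [remoteProb, show (2 : ℝ) / (alphabetSize d : ℝ) ^ 2
      = 2 * (1 / (alphabetSize d : ℝ)) ^ 2 by ring]
    have hx : 1 / (alphabetSize d : ℝ) ≤ 1 / 9 := one_div_le_one_div_of_le (by norm_num) hQ9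
    have hx0 : 0 ≤ 1 / (alphabetSize d : ℝ) := by positivity
    generalize (1 - 1 / (alphabetSize d : ℝ)) ^ (d - 2) = s at *
    generalize (1 - 2 / (alphabetSize d : ℝ)) ^ (d - 2) = t at *
    generalize 1 / (alphabetSize d : ℝ) = x at *
    have hs : 0.5 ≤ s := by nlinarith
    -- The constant exceeds 16/81, the maximum of 2x(1 - x) for x ≤ 1/9. Dividing by 1 - x gives
    -- `key`, which makes `remoteProb` at most the square of `deletionProb`.
    have hf3 : 0.1976 ≤ (1 - s * (1 - x)) * (s * (1 - x)) := by nlinarith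
    have key : 2 * x ≤ (1 - s * (1 - x)) * s := by nlinarith
    nlinarith [mul_le_mul_of_nonneg_left key hx0, mul_le_mul_of_nonneg_left hb
      (show 0 ≤ 1 - x by linarith)]

end Numerics

/-! ### The asymptotic bound -/

section Asymptotics

open Filter Topology

/-- The number of coordinates of the labels. -/
noncomputable def blockCount (ε : ℝ) (d m : ℕ) : ℕ :=
  ⌊(d * Real.logb 2 (Real.exp 1) * Real.logb 2 m * (1 + ε)) / alphabetSize d⌋₊

lemma logb_two_exp_one : Real.logb 2 (Real.exp 1) = 1 / Real.log 2 := by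
  rw [Real.logb, Real.log_exp]

lemma logb_two_natCast_nonneg (m : ℕ) : 0 ≤ Real.logb 2 (m : ℝ) := by
  rcases Nat.eq_zero_or_pos m with rfl | h
  · simp
  · exact Real.logb_nonneg (by norm_num) (by exact_mod_cast h)

variable {ε : ℝ} {d m : ℕ}

lemma blockCount_mul_le (hε : 0 ≤ ε) (hd : 1 ≤ d) :
    ((blockCount ε d m * alphabetSize d : ℕ) : ℝ)
      ≤ d * Real.logb 2 (Real.exp 1) * Real.logb 2 m * (1 + ε) := by
  have hQ : (0 : ℝ) < alphabetSize d := by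
    exact_mod_cast lt_of_lt_of_le two_pos (two_le_alphabetSize hd)
  have hL := logb_two_natCast_nonneg m
  have hl : 0 < Real.log 2 := Real.log_pos (by norm_num)
  push_cast
  rw [← le_div_iff₀ hQ]
  refine Nat.floor_le (div_nonneg ?_ hQ.le)
  rw [logb_two_exp_one]
  positivity

/-- The floor loses at most 1, hence at most θ ≤ 2 in the product, and (ε/2) log₂ m ≥ 2 absorbs
this. -/
lemma le_sizeRatio_mul_blockCount (hε : 0 < ε) (hd : 1 ≤ d) (hm : 4 / ε ≤ Real.logb 2 m) :
    (1 + ε / 2) * Real.logb 2 m ≤ sizeRatio d * blockCount ε d m := by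
  have hd' : (0 : ℝ) < d := by exact_mod_cast hd
  have hQ : (0 : ℝ) < alphabetSize d := by
    exact_mod_cast lt_of_lt_of_le two_pos (two_le_alphabetSize hd)
  have hl : 0 < Real.log 2 := Real.log_pos (by norm_num)
  have h1 := one_le_sizeRatio hd
  have h2 := sizeRatio_le_two hd
  have h3 := (Nat.lt_floor_add_one
    ((d * Real.logb 2 (Real.exp 1) * Real.logb 2 m * (1 + ε)) / alphabetSize d)).le
  change _ ≤ (blockCount ε d m : ℝ) + 1 at h3
  have h4 := mul_le_mul_of_nonneg_left h3 (show 0 ≤ sizeRatio d by linarith)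
  have h5 : sizeRatio d * ((d * Real.logb 2 (Real.exp 1) * Real.logb 2 m * (1 + ε))
      / alphabetSize d) = Real.logb 2 m * (1 + ε) := by
    rw [sizeRatio, logb_two_exp_one]
    field_simp
  rw [h5] at h4
  rw [div_le_iff₀ hε] at hm
  nlinarith

lemma pow_blockCount_le (hε : 0 < ε) (hd : 1 ≤ d) (hm : 4 / ε ≤ Real.logb 2 m) (hm0 : 0 < m)
    {p τ : ℝ} (hp : 0 ≤ p) (hτ : 0 ≤ τ) (h : p ≤ 2 ^ (-(τ * sizeRatio d))) :
    p ^ blockCount ε d m ≤ (m : ℝ) ^ (-(τ * (1 + ε / 2))) := by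
  have hm' : (0 : ℝ) < m := by exact_mod_cast hm0
  refine (pow_le_pow_left₀ hp h _).trans ?_
  have h1 : (m : ℝ) ^ (-(τ * (1 + ε / 2)))
      = 2 ^ (Real.logb 2 m * (-(τ * (1 + ε / 2)))) := by
    rw [Real.rpow_mul (by norm_num), Real.rpow_logb (by norm_num) (by norm_num) hm']
  rw [h1, ← Real.rpow_natCast, ← Real.rpow_mul (by norm_num)]
  refine Real.rpow_le_rpow_of_exponent_le (by norm_num) ?_
  have := mul_le_mul_of_nonneg_left (le_sizeRatio_mul_blockCount hε hd hm) hτ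
  linarith

lemma eventually_le_logb (c : ℝ) : ∀ᶠ m : ℕ in atTop, c ≤ Real.logb 2 m :=
  ((Real.tendsto_logb_atTop (by norm_num)).comp tendsto_natCast_atTop_atTop).eventually_ge_atTop c

/-- `N` tests suffice for all families of `m` edges of size at most `d`. -/
def Sufficient.{u} (N d m : ℕ) : Prop :=
  ∀ (V : Type u) [Fintype V] [DecidableEq V] (E : Finset (Finset V)), E.card = m →
    (∀ e ∈ E, e.card ≤ d) → Separable E N

lemma tendsto_rpow_neg_natCast {δ : ℝ} (hδ : 0 < δ) :
    Tendsto (fun m : ℕ => (m : ℝ) ^ (-δ)) atTop (𝓝 0) :=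
  (tendsto_rpow_neg_atTop hδ).comp tendsto_natCast_atTop_atTop

lemma tendsto_logb_mul_rpow_neg_natCast {δ : ℝ} (hδ : 0 < δ) :
    Tendsto (fun m : ℕ => Real.logb 2 m * (m : ℝ) ^ (-δ)) atTop (𝓝 0) := by
  have h := ((isLittleO_log_rpow_atTop hδ).tendsto_div_nhds_zero.comp
    tendsto_natCast_atTop_atTop).div_const (Real.log 2)
  rw [zero_div] at h
  refine h.congr fun m => ?_
  simp only [Function.comp_apply, Real.logb]
  rw [Real.rpow_neg (Nat.cast_nonneg _)]
  ring

/-- The bound for edges of bounded size. -/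
lemma eventually_sufficient_of_fixed.{u} (hε : 0 < ε) (hd : 2 ≤ d) :
    ∀ᶠ m : ℕ in atTop, Sufficient.{u} (blockCount ε d m * alphabetSize d) d m := by
  have hd1 : 1 ≤ d := by omega
  have hQ := two_le_alphabetSize hd1
  set C : ℝ := 4 ^ (2 * d) * (2 * d + (2 * d + 2 * d ^ 3) + 1) + 8 * d ^ 2 with hC
  have hlim := (tendsto_rpow_neg_natCast (half_pos hε)).const_mul C
  rw [mul_zero] at hlim
  filter_upwards [eventually_le_logb (4 / ε), eventually_ge_atTop 2,
    hlim.eventually_lt_const one_pos] with m hm hm2 hlt V _ _ E hE hEd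
  have hm0 : 0 < m := by omega
  have hx2 : (2 : ℝ) ≤ m := by exact_mod_cast hm2
  have hx : (0 : ℝ) < m := by linarith
  have p0 := pow_blockCount_le hε hd1 hm hm0 (deletionProb_nonneg hQ) zero_le_one
    (by rw [one_mul]; exact deletionProb_le hd1)
  have p1 := pow_blockCount_le hε hd1 hm hm0 (exchangeProb_nonneg hQ hd1) (by norm_num)
    (exchangeProb_le hd)
  have p2 := pow_blockCount_le hε hd1 hm hm0 (remoteProb_nonneg hQ) zero_le_two (remoteProb_le hd)
  have n1 := pow_nonneg (exchangeProb_nonneg hQ hd1) (blockCount ε d m)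
  set B := blockCount ε d m
  set Q := alphabetSize d
  set s := Real.sqrt m with hs
  have hs2 : s * s = m := Real.mul_self_sqrt hx.le
  have hs1 : 1 < s := by rw [hs, Real.lt_sqrt zero_le_one]; linarith
  -- The threshold √m balances the two costs: light exchange pairs number about dm^(3/2), and at
  -- most d√m heavy cores cause conflicts among at most dm vertices.
  set h := ⌈s⌉₊ with hh
  have hsh : s ≤ h := Nat.le_ceil s
  have hhs : (h : ℝ) ≤ 2 * s := by
    have := Nat.ceil_lt_add_one (show 0 ≤ s by linarith)
    linarith
  have hh2 : 2 ≤ h := by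
    have : 1 < h := by exact_mod_cast hs1.trans_le hsh
    omega
  have hH : ((heavyCores E h).card : ℝ) ≤ d * s := by
    have h1 := card_heavyCores_mul_le hEd h
    rw [hE] at h1
    have h2 : ((heavyCores E h).card : ℝ) * h ≤ m * d := by exact_mod_cast h1
    have h3 : ((heavyCores E h).card : ℝ) * s ≤ m * d :=
      (mul_le_mul_of_nonneg_left hsh (Nat.cast_nonneg _)).trans h2
    rw [← hs2] at h3
    nlinarith
  have hS : ((heavyVertices E h).card : ℝ) ≤ d ^ 2 * s := by
    have h1 := card_heavyVertices_le hEd (show 1 ≤ h by omega)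
    have h2 : ((heavyVertices E h).card : ℝ) ≤ (heavyCores E h).card * d := by exact_mod_cast h1
    have h3 := mul_le_mul_of_nonneg_right hH (Nat.cast_nonneg (α := ℝ) d)
    linarith
  have hI : (insertionCount E : ℝ) ≤ m * d := by
    have := insertionCount_le_mul hEd
    rw [hE] at this
    exact_mod_cast this
  set δ := ε / 2
  have hδ : 0 < δ := half_pos hε
  set y := (m : ℝ) ^ (-δ) with hy
  have hy0 : 0 < y := Real.rpow_pos_of_pos hx _
  have a0 : m * deletionProb d Q ^ B ≤ y := by
    refine (mul_le_mul_of_nonneg_left p0 hx.le).trans (le_of_eq ?_)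
    nth_rewrite 1 [← Real.rpow_one (m : ℝ)]
    rw [← Real.rpow_add hx]
    congr 1
    ring
  have a1 : m * s * exchangeProb d Q ^ B ≤ y := by
    refine (mul_le_mul_of_nonneg_left p1 (by positivity)).trans ?_
    nth_rewrite 1 [← Real.rpow_one (m : ℝ)]
    rw [hs, Real.sqrt_eq_rpow, ← Real.rpow_add hx, ← Real.rpow_add hx]
    exact Real.rpow_le_rpow_of_exponent_le (by linarith) (by linarith)
  have a2 : (m : ℝ) ^ 2 * remoteProb d Q ^ B ≤ y := by
    refine (mul_le_mul_of_nonneg_left p2 (by positivity)).trans ?_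
    rw [← Real.rpow_natCast, ← Real.rpow_add hx]
    exact Real.rpow_le_rpow_of_exponent_le (by linarith) (by push_cast; linarith)
  refine separable_of_heavyCores hQ hd1 (by omega) hEd hh2 (lt_of_le_of_lt ?_ hlt)
  rw [hE]
  push_cast
  have hd0 : (0 : ℝ) ≤ d := Nat.cast_nonneg d
  have b0 : 2 * (insertionCount E : ℝ) * deletionProb d Q ^ B ≤ 2 * d * y := by
    have h1 := mul_le_mul_of_nonneg_right hI
      (pow_nonneg (deletionProb_nonneg (d := d) hQ) B)
    have h2 := mul_le_mul_of_nonneg_left a0 hd0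
    linarith
  have b1 : (m : ℝ) * (d * (h + 2 * (heavyVertices E h).card)) * exchangeProb d Q ^ B
      ≤ (2 * d + 2 * d ^ 3) * y := by
    have h1 : (h : ℝ) + 2 * (heavyVertices E h).card ≤ (2 + 2 * d ^ 2) * s := by linarith
    calc _ ≤ (m : ℝ) * (d * ((2 + 2 * d ^ 2) * s)) * exchangeProb d Q ^ B := by gcongr
      _ = (2 * d + 2 * d ^ 3) * (m * s * exchangeProb d Q ^ B) := by ring
      _ ≤ _ := mul_le_mul_of_nonneg_left a1 (by positivity)
  have b2 : 8 * ((m : ℝ) * d) * ((heavyCores E h).card * exchangeProb d Q ^ B)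
      ≤ 8 * d ^ 2 * y := by
    calc _ ≤ 8 * ((m : ℝ) * d) * (d * s * exchangeProb d Q ^ B) := by gcongr
      _ = 8 * d ^ 2 * (m * s * exchangeProb d Q ^ B) := by ring
      _ ≤ _ := mul_le_mul_of_nonneg_left a1 (by positivity)
  have b3 := mul_le_mul_of_nonneg_left (add_le_add (add_le_add b0 b1) a2)
    (show (0 : ℝ) ≤ 4 ^ (2 * d) by positivity)
  rw [hC]
  linarith

/-- The bound for edges of large size. -/
lemma exists_eventually_sufficient_of_large.{u} (hε : 0 < ε) :
    ∃ d₀ : ℕ, 2 ≤ d₀ ∧ ∀ᶠ m : ℕ in atTop, ∀ d, d₀ ≤ d →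
      Sufficient.{u} (blockCount ε d m * alphabetSize d) d m := by
  set δ := ε / 2 with hδ'
  have hδ : 0 < δ := half_pos hε
  -- Slightly below 2, so that 2^(-τθ) leaves room for the error 1/Q, yet τ(1 + δ) > 2, so that m²
  -- pairs are affordable.
  set τ := 2 / (1 + δ / 2) with hτ
  have hτ0 : 0 < τ := by positivity
  have hτ2 : τ < 2 := by rw [hτ, div_lt_iff₀ (by positivity)]; linarith
  have hτδ : τ * (1 + δ) = 2 + δ / (1 + δ / 2) := by
    rw [hτ]; field_simp; ring
  -- A lower bound for 2^(-τθ) - 2^(-2θ) over 1 ≤ θ ≤ 2; once d ≥ 1/c, the error 1/Q is below it.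
  set c : ℝ := 2 ^ (-4 : ℝ) * (2 ^ (2 - τ) - 1) with hc
  have hc0 : 0 < c := by
    refine mul_pos (by positivity) (sub_pos.2 ?_)
    exact Real.one_lt_rpow (by norm_num) (by linarith)
  have hlim := ((tendsto_logb_mul_rpow_neg_natCast hδ).add
    (tendsto_rpow_neg_natCast (show 0 < δ / (1 + δ / 2) by positivity))).add
    (tendsto_rpow_neg_natCast (show 0 < 2 * δ by positivity))
  simp only [add_zero] at hlim
  refine ⟨max 2 ⌈1 / c⌉₊, le_max_left _ _, ?_⟩
  filter_upwards [eventually_le_logb (4 / ε), eventually_ge_atTop 2,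
    hlim.eventually_lt_const one_pos] with m hm hm2 hlt d hd V _ _ E hE hEd
  have hd2 : 2 ≤ d := (le_max_left _ _).trans hd
  have hd1 : 1 ≤ d := by omega
  have hQ := two_le_alphabetSize hd1
  have hm0 : 0 < m := by omega
  have hx2 : (2 : ℝ) ≤ m := by exact_mod_cast hm2
  have hx : (0 : ℝ) < m := by linarith
  have hexch : exchangeProb d (alphabetSize d) ≤ 2 ^ (-(τ * sizeRatio d)) := by
    refine (exchangeProb_le_rpow_add hd1).trans ?_
    have h1 := one_le_sizeRatio hd1
    have h2 := sizeRatio_le_two hd1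
    have h3 : 1 / (alphabetSize d : ℝ) ≤ c := by
      rw [div_le_comm₀ (by exact_mod_cast (show 0 < alphabetSize d by omega)) hc0]
      have h4 : (⌈1 / c⌉₊ : ℝ) ≤ alphabetSize d := by
        exact_mod_cast ((le_max_right _ _).trans hd).trans (lt_alphabetSize hd1).le
      exact (Nat.le_ceil _).trans h4
    have h4 : c ≤ 2 ^ (-(2 * sizeRatio d)) * (2 ^ ((2 - τ) * sizeRatio d) - 1) := by
      refine mul_le_mul ?_ ?_ ?_ (by positivity)
      · exact Real.rpow_le_rpow_of_exponent_le (by norm_num) (by linarith)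
      · refine sub_le_sub_right (Real.rpow_le_rpow_of_exponent_le (by norm_num) ?_) 1
        nlinarith
      · rw [sub_nonneg]
        exact Real.one_le_rpow (by norm_num) (by linarith)
    rw [mul_sub, mul_one, ← Real.rpow_add (by norm_num)] at h4
    rw [show -(τ * sizeRatio d) = -(2 * sizeRatio d) + (2 - τ) * sizeRatio d by ring]
    linarith
  have p0 := pow_blockCount_le hε hd1 hm hm0 (deletionProb_nonneg hQ) zero_le_one
    (by rw [one_mul]; exact deletionProb_le hd1)
  have p1 := pow_blockCount_le hε hd1 hm hm0 (exchangeProb_nonneg hQ hd1) hτ0.le hexch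
  have p2 := pow_blockCount_le hε hd1 hm hm0 (remoteProb_nonneg hQ) zero_le_two (remoteProb_le hd2)
  rw [← hδ'] at p0 p1 p2
  rw [hτδ] at p1
  have n0 := pow_nonneg (deletionProb_nonneg (d := d) hQ) (blockCount ε d m)
  -- The bound md would make the threshold for m depend on d.
  have hI := two_mul_insertionCount_le E
  rw [hE] at hI
  have hL := logb_two_natCast_nonneg m
  refine separable_of_first_moment hQ hd1 hEd (lt_of_le_of_lt ?_ hlt)
  rw [hE]
  refine add_le_add (add_le_add ?_ ?_) ?_
  · refine (mul_le_mul hI p0 n0 (by positivity)).trans (le_of_eq ?_)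
    rw [mul_comm (m : ℝ), mul_assoc]
    congr 1
    nth_rewrite 1 [← Real.rpow_one (m : ℝ)]
    rw [← Real.rpow_add hx]
    congr 1
    ring
  · refine (mul_le_mul_of_nonneg_left p1 (by positivity)).trans (le_of_eq ?_)
    rw [← Real.rpow_natCast, ← Real.rpow_add hx]
    congr 1
    push_cast
    ring
  · refine (mul_le_mul_of_nonneg_left p2 (by positivity)).trans (le_of_eq ?_)
    rw [← Real.rpow_natCast, ← Real.rpow_add hx]
    congr 1
    push_cast
    ring

end Asymptotics

/-! ### Small cases -/

section SmallCases

variable {V : Type*} [Fintype V] [DecidableEq V]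

lemma separable_of_card_le_one {E : Finset (Finset V)} (hE : E.card ≤ 1) (N : ℕ) :
    Separable E N :=
  ⟨fun _ => ∅, fun e he e' he' _ => Finset.card_le_one.1 hE e he e' he'⟩

/-- The tests are the differences of two edges. This crude bound gives a finite error term for each
m. -/
lemma separable_card_mul_card (E : Finset (Finset V)) : Separable E (E.card * E.card) := by
  have h := separable_of_fintype (E := E) (fun i : E × E => (i.1 : Finset V) \ i.2) ?_
  · simpa using h
  · intro e he e' he' h
    have key : ∀ a ∈ E, ∀ b ∈ E,
        (∀ i : E × E, (((i.1 : Finset V) \ i.2) ∩ a).Nonempty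
          ↔ (((i.1 : Finset V) \ i.2) ∩ b).Nonempty) → a ⊆ b := by
      intro a ha b hb hab x hxa
      by_contra hxb
      obtain ⟨y, hy⟩ := (hab (⟨a, ha⟩, ⟨b, hb⟩)).1 ⟨x, by simp [hxa, hxb]⟩
      simp only [Finset.mem_inter, Finset.mem_sdiff] at hy
      exact hy.1.2 hy.2
    exact Finset.Subset.antisymm (key e he e' he' h) (key e' he' e he fun i => (h i).symm)

/-- Edges with at most one vertex are found by binary search. -/
lemma separable_of_card_le_one_of_mem {E : Finset (Finset V)} (hE : ∀ e ∈ E, e.card ≤ 1) {N : ℕ}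
    (hN : E.card < 2 ^ N) : Separable E N := by
  set U := E.biUnion id with hU
  have hUE : U.card ≤ E.card := by
    have := Finset.card_biUnion_le_card_mul E id 1 hE
    rwa [mul_one] at this
  -- Numbers start at 1, since 0 has no positive bit and stands for the empty edge.
  let num : V → ℕ := fun v => if h : v ∈ U then (U.equivFin ⟨v, h⟩ : ℕ) + 1 else 0
  have hlt : ∀ v, num v < 2 ^ N := by
    intro v
    by_cases hv : v ∈ U
    · simp only [num, dif_pos hv]
      have := (U.equivFin ⟨v, hv⟩).2
      omega
    · simp [num, hv]
  have hinj : ∀ v ∈ U, ∀ w ∈ U, num v = num w → v = w := by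
    intro v hv w hw h
    simp only [num, dif_pos hv, dif_pos hw, add_left_inj] at h
    have := U.equivFin.injective (Fin.ext h)
    simpa using this
  have hpos : ∀ v ∈ U, num v ≠ 0 := by
    intro v hv
    simp [num, hv]
  have hbit : ∀ a b : ℕ, a < 2 ^ N → b < 2 ^ N → (∀ i : Fin N, a.testBit i ↔ b.testBit i) →
      a = b := by
    intro a b ha hb h
    refine Nat.eq_of_testBit_eq fun i => ?_
    by_cases hi : i < N
    · have := h ⟨i, hi⟩
      exact Bool.eq_iff_iff.2 this
    · have h2 : 2 ^ N ≤ 2 ^ i := Nat.pow_le_pow_right two_pos (by omega)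
      rw [Nat.testBit_eq_false_of_lt (ha.trans_le h2), Nat.testBit_eq_false_of_lt (hb.trans_le h2)]
  refine ⟨fun i => Finset.univ.filter fun v => (num v).testBit i, fun e he e' he' h => ?_⟩
  have hmem : ∀ v, {v} ∈ E → v ∈ U := fun v hv =>
    Finset.mem_biUnion.2 ⟨_, hv, Finset.mem_singleton_self v⟩
  have hne : ∀ v : V, ∀ i : Fin N,
      ((Finset.univ.filter fun v => (num v).testBit i) ∩ {v}).Nonempty ↔ (num v).testBit i := by
    intro v i
    simp [Finset.Nonempty]
  have hdich : ∀ e ∈ E, e = ∅ ∨ ∃ v, e = {v} := by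
    intro e he
    have := hE e he
    rcases Nat.lt_or_ge e.card 1 with h1 | h1
    · exact Or.inl (Finset.card_eq_zero.1 (by omega))
    · exact Or.inr (Finset.card_eq_one.1 (by omega))
  rcases hdich e he with rfl | ⟨v, rfl⟩ <;> rcases hdich e' he' with rfl | ⟨w, rfl⟩
  · rfl
  · refine absurd (hbit (num w) 0 (hlt w) (by positivity) fun i => ?_) (hpos w (hmem w he'))
    rw [← hne w i, ← h i]
    simp
  · refine absurd (hbit (num v) 0 (hlt v) (by positivity) fun i => ?_) (hpos v (hmem v he))
    rw [← hne v i, h i]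
    simp
  · rw [hinj v (hmem v he) w (hmem w he') (hbit _ _ (hlt v) (hlt w) fun i => ?_)]
    rw [← hne v i, ← hne w i, h i]

end SmallCases

/-! ### Uniform bounds -/

section Uniform

open Filter Topology

/-- All families of `m` edges satisfy the bound with error term `ε`. -/
def BoundHolds.{u} (ε : ℝ) (m : ℕ) : Prop :=
  ∀ (d : ℕ) (V : Type u) [Fintype V] [DecidableEq V] (E : Finset (Finset V)), E.card = m →
    (∀ e ∈ E, e.card ≤ d) → ∃ N : ℕ, Separable E N ∧
      (N : ℝ) ≤ d * Real.logb 2 (Real.exp 1) * Real.logb 2 m * (1 + ε)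

lemma le_logb_two_exp_one : 1.44 ≤ Real.logb 2 (Real.exp 1) := by
  rw [logb_two_exp_one, le_div_iff₀ (Real.log_pos (by norm_num))]
  linarith [Real.log_two_lt_d9]

lemma BoundHolds.mono.{u} {ε ε' : ℝ} {m : ℕ} (h : BoundHolds.{u} ε m) (hε : ε ≤ ε') :
    BoundHolds.{u} ε' m := by
  intro d V _ _ E hE hEd
  obtain ⟨N, hN, hle⟩ := h d V E hE hEd
  refine ⟨N, hN, hle.trans (mul_le_mul_of_nonneg_left (by linarith) ?_)⟩
  have := logb_two_natCast_nonneg m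
  have := le_logb_two_exp_one
  exact mul_nonneg (mul_nonneg (Nat.cast_nonneg d) (by linarith)) (by assumption)

lemma card_le_one_of_forall_card_le_zero {V : Type*} {E : Finset (Finset V)}
    (hE : ∀ e ∈ E, e.card ≤ 0) :
    E.card ≤ 1 :=
  Finset.card_le_one.2 fun e he e' he' => by
    rw [Finset.card_eq_zero.1 (Nat.le_zero.1 (hE e he)),
      Finset.card_eq_zero.1 (Nat.le_zero.1 (hE e' he'))]

lemma exists_boundHolds.{u} (m : ℕ) : ∃ ε, 0 ≤ ε ∧ BoundHolds.{u} ε m := by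
  rcases Nat.lt_or_ge 1 m with hm | hm
  swap
  · refine ⟨0, le_rfl, fun d V _ _ E hE _ => ⟨0, separable_of_card_le_one (by omega) 0, ?_⟩⟩
    have := logb_two_natCast_nonneg m
    have := le_logb_two_exp_one
    push_cast
    exact mul_nonneg (mul_nonneg (mul_nonneg (Nat.cast_nonneg d) (by linarith)) (by assumption))
      (by norm_num)
  have hm' : (1 : ℝ) < m := by exact_mod_cast hm
  have hL : 0 < Real.logb 2 m := Real.logb_pos (by norm_num) hm'
  have hc := le_logb_two_exp_one
  have hcL : 0 < Real.logb 2 (Real.exp 1) * Real.logb 2 m := mul_pos (by linarith) hL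
  refine ⟨m * m / (Real.logb 2 (Real.exp 1) * Real.logb 2 m), by positivity,
    fun d V _ _ E hE hEd => ⟨E.card * E.card, separable_card_mul_card E, ?_⟩⟩
  rcases Nat.eq_zero_or_pos d with rfl | hd
  · have := card_le_one_of_forall_card_le_zero hEd
    omega
  have hd' : (1 : ℝ) ≤ d := by exact_mod_cast hd
  rw [hE, mul_assoc (d : ℝ), mul_add, mul_one, mul_assoc (d : ℝ), mul_div_cancel₀ _ hcL.ne']
  push_cast
  nlinarith [mul_pos (show (0 : ℝ) < d by linarith) hcL,
    mul_nonneg (show (0 : ℝ) ≤ d - 1 by linarith)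
    (mul_nonneg (Nat.cast_nonneg (α := ℝ) m) (Nat.cast_nonneg (α := ℝ) m))]

lemma eventually_boundHolds.{u} {ε : ℝ} (hε : 0 < ε) : ∀ᶠ m in atTop, BoundHolds.{u} ε m := by
  obtain ⟨d₀, hd₀, hlarge⟩ := exists_eventually_sufficient_of_large.{u} hε
  have hfixed : ∀ᶠ m : ℕ in atTop, ∀ d ∈ Finset.Ico 2 d₀,
      Sufficient.{u} (blockCount ε d m * alphabetSize d) d m :=
    (Finset.eventually_all _).2 fun d hd =>
      eventually_sufficient_of_fixed hε (Finset.mem_Ico.1 hd).1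
  -- For d = 1, log₂ m + 2 ≤ 1.44 log₂ m needs log₂ m ≥ 2/0.44, and 5 is enough.
  filter_upwards [hlarge, hfixed, eventually_le_logb 5, eventually_ge_atTop 2]
    with m hm hm' hL hm2 d V _ _ E hE hEd
  have hc := le_logb_two_exp_one
  rcases Nat.lt_or_ge d 2 with hd | hd
  · interval_cases d
    · have := card_le_one_of_forall_card_le_zero hEd
      omega
    · refine ⟨Nat.clog 2 (m + 1), separable_of_card_le_one_of_mem hEd ?_, ?_⟩
      · rw [hE]
        exact lt_of_lt_of_le (Nat.lt_succ_self m) (Nat.le_pow_clog one_lt_two _)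
      · have hx : (2 : ℝ) ≤ m := by exact_mod_cast hm2
        have h1 : (Nat.clog 2 (m + 1) : ℝ) ≤ Real.logb 2 m + 2 := by
          have h2 : 2 ^ (Nat.clog 2 (m + 1) - 1) < m + 1 :=
            Nat.pow_pred_clog_lt_self one_lt_two (by omega)
          have h3 : ((Nat.clog 2 (m + 1) - 1 : ℕ) : ℝ) ≤ Real.logb 2 m := by
            rw [Real.le_logb_iff_rpow_le (by norm_num) (by linarith), Real.rpow_natCast]
            exact_mod_cast Nat.lt_succ_iff.1 h2
          have h4 : Nat.clog 2 (m + 1) ≤ (Nat.clog 2 (m + 1) - 1) + 1 := by omega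
          have h5 : (Nat.clog 2 (m + 1) : ℝ) ≤ ((Nat.clog 2 (m + 1) - 1 : ℕ) : ℝ) + 1 := by
            exact_mod_cast h4
          linarith
        push_cast
        have h6 : 1.44 * Real.logb 2 m ≤ Real.logb 2 (Real.exp 1) * Real.logb 2 m :=
          mul_le_mul_of_nonneg_right hc (by linarith)
        have h7 : 0 ≤ Real.logb 2 (Real.exp 1) * Real.logb 2 m * ε :=
          mul_nonneg (mul_nonneg (by linarith) (by linarith)) hε.le
        linarith
  · refine ⟨blockCount ε d m * alphabetSize d, ?_, blockCount_mul_le hε.le (by omega)⟩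
    rcases Nat.lt_or_ge d d₀ with h | h
    · exact hm' d (Finset.mem_Ico.2 ⟨hd, h⟩) V E hE hEd
    · exact hm d h V E hE hEd

/-- Take η(m) to be the infimum of the admissible errors; the summand 1/(m + 1) is there because the
infimum need not be attained. -/
lemma exists_tendsto_boundHolds.{u} :
    ∃ η : ℕ → ℝ, Tendsto η atTop (𝓝 0) ∧ ∀ m, BoundHolds.{u} (η m) m := by
  let s : ℕ → Set ℝ := fun m => {ε | 0 ≤ ε ∧ BoundHolds.{u} ε m}
  have hbdd : ∀ m, BddBelow (s m) := fun m => ⟨0, fun ε hε => hε.1⟩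
  have hne : ∀ m, (s m).Nonempty := fun m => exists_boundHolds m
  have h0 : ∀ m, 0 ≤ sInf (s m) := fun m => le_csInf (hne m) fun ε hε => hε.1
  refine ⟨fun m => sInf (s m) + 1 / ((m : ℝ) + 1), ?_, fun m => ?_⟩
  · have h1 : Tendsto (fun m => sInf (s m)) atTop (𝓝 0) := by
      refine tendsto_order.2 ⟨fun a ha => Eventually.of_forall fun m => ha.trans_le (h0 m),
        fun a ha => ?_⟩
      filter_upwards [eventually_boundHolds.{u} (half_pos ha)] with m hm
      exact (csInf_le (hbdd m) ⟨(half_pos ha).le, hm⟩).trans_lt (half_lt_self ha)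
    have h2 := h1.add (tendsto_one_div_add_atTop_nhds_zero_nat (𝕜 := ℝ))
    rwa [add_zero] at h2
  · obtain ⟨ε, hε, hlt⟩ := exists_lt_of_csInf_lt (hne m)
      (lt_add_of_pos_right (sInf (s m)) (show 0 < 1 / ((m : ℝ) + 1) by positivity))
    exact hε.2.mono hlt.le

end Uniform

/-! ### Hypergraphs -/

section Hypergraphs

open Classical in
-- The decoder picks any edge consistent with the results; separability makes it unique.
lemma exists_nonadaptiveAlgorithm {V : Type*} (H : Hypergraph V) (E : Finset (Finset H.vertexSet))
    (hE : ∀ e ∈ H.edgeSet, ∃ f ∈ E, e = Subtype.val '' (f : Set H.vertexSet)) {N : ℕ}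
    [Fintype H.vertexSet] (hN : Separable E N) :
    ∃ A : NonadaptiveAlgorithm H N, A.FindsDefectiveEdge := by
  obtain ⟨t, ht⟩ := hN
  let test : Fin N → Set V := fun i => Subtype.val '' (t i : Set H.vertexSet)
  have hinter : ∀ (f : Finset H.vertexSet) i,
      (test i ∩ Subtype.val '' (f : Set H.vertexSet)).Nonempty ↔ (t i ∩ f).Nonempty := by
    intro f i
    rw [← Set.image_inter Subtype.val_injective, Set.image_nonempty, ← Finset.coe_inter,
      Finset.coe_nonempty]
  refine ⟨⟨test, fun i => ?_, fun r => if h : ∃ e ∈ H.edgeSet, (fun i => (test i ∩ e).Nonempty) = r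
    then h.choose else ∅⟩, fun e he => ?_⟩
  · rintro _ ⟨v, -, rfl⟩
    exact v.2
  · have h : ∃ e' ∈ H.edgeSet,
        (fun i => (test i ∩ e').Nonempty) = fun i => (test i ∩ e).Nonempty := ⟨e, he, rfl⟩
    change (if h : ∃ e' ∈ H.edgeSet, (fun i => (test i ∩ e').Nonempty)
      = fun i => (test i ∩ e).Nonempty then h.choose else ∅) = e
    rw [dif_pos h]
    obtain ⟨h1, h2⟩ := h.choose_spec
    set e' := h.choose
    obtain ⟨f, hf, hef⟩ := hE e he
    obtain ⟨f', hf', hef'⟩ := hE e' h1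
    have hff : f' = f := by
      refine ht f' hf' f hf fun i => ?_
      rw [← hinter, ← hinter, ← hef, ← hef']
      exact iff_of_eq (congrFun h2 i)
    rw [hef, hef', hff]

end Hypergraphs

end GroupTesting

theorem theorem2 :
    ∃ η : ℕ → ℝ, Filter.Tendsto η Filter.atTop (nhds 0) ∧
      ∀ (V : Type*) (H : Hypergraph V), H.vertexSet.Finite →
        ∀ d : ℕ, (∀ e ∈ H.edgeSet, e.ncard ≤ d) →
          ∃ (N : ℕ) (A : GroupTesting.NonadaptiveAlgorithm H N),
            A.FindsDefectiveEdge ∧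
            (N : ℝ) ≤ (d : ℝ) * Real.logb 2 (Real.exp 1) *
              Real.logb 2 (H.edgeSet.ncard : ℝ) * (1 + η H.edgeSet.ncard) := by
  classical
  obtain ⟨η, hη, hbound⟩ := GroupTesting.exists_tendsto_boundHolds
  refine ⟨η, hη, fun V H hfin d hd => ?_⟩
  have := hfin.fintype
  let E : Finset (Finset H.vertexSet) :=
    Finset.univ.filter fun f => Subtype.val '' (f : Set H.vertexSet) ∈ H.edgeSet
  have himage : Set.BijOn (fun f : Finset H.vertexSet => Subtype.val '' (f : Set H.vertexSet))
      E H.edgeSet := by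
    refine ⟨fun f hf => (Finset.mem_filter.1 hf).2, fun f _ g _ h => ?_, fun e he => ?_⟩
    · exact Finset.coe_injective (Set.image_injective.2 Subtype.val_injective h)
    · have hsub : e ⊆ H.vertexSet := H.subset_vertexSet_of_mem_edgeSet' he
      have h1 : Subtype.val '' (((Subtype.val ⁻¹' e : Set H.vertexSet).toFinset :
          Finset H.vertexSet) : Set H.vertexSet) = e := by
        rw [Set.coe_toFinset, Subtype.image_preimage_coe, Set.inter_eq_right.2 hsub]
      exact ⟨_, Finset.mem_coe.2 (Finset.mem_filter.2
        ⟨Finset.mem_univ _, by rw [h1]; exact he⟩), h1⟩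
  have hcard : E.card = H.edgeSet.ncard := by
    rw [← himage.image_eq, himage.injOn.ncard_image, Set.ncard_coe_finset]
  obtain ⟨N, hN, hle⟩ := hbound H.edgeSet.ncard d H.vertexSet E hcard fun f hf => by
    have h1 := hd _ (Finset.mem_filter.1 hf).2
    rwa [Set.ncard_image_of_injective _ Subtype.val_injective, Set.ncard_coe_finset] at h1
  obtain ⟨A, hA⟩ := GroupTesting.exists_nonadaptiveAlgorithm H E
    (fun e he => by
      obtain ⟨f, hf, hfe⟩ := himage.surjOn he
      exact ⟨f, hf, hfe.symm⟩) hN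
  exact ⟨N, A, hA, hle⟩
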